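/- **Theorem 2.1 (special coordinates).** Let $\Omega=\{w\in\mathbb C^3 : R(w)<0\}$ be a smoothly bounded (Levi) pseudoconvex domain with $C^\infty$ defining function $R$ ($dR\neq 0$ on $b\Omega$), and let $0\in b\Omega$. Let $T_{BG}(0)=m<\infty$, where $T_{BG}(0)$ is the Bloom–Graham type, i.e. the maximal order of vanishing at $0$ of $R\circ\varphi$ over all germs at $0$ of holomorphic maps $\varphi:\mathbb C^2\to\mathbb C^3$ with $\varphi(0)=0$ and $d\varphi(0)$ injective (the maximal order of contact of $b\Omega$ with smooth $2$-dimensional complex submanifolds). Let $V$ be a smooth $1$-dimensional complex analytic variety through $0$, and let $\eta\ge m$ be an integer such that, for some constant $C$, $|R(w)|\le C|w|^\eta$ for all $w\in V$ sufficiently close to $0$. Then there are a holomorphic coordinate system $z=(z_1,z_2,z_3)$ about $0$, $w=\Psi(z)$ with $\Psi(0)=0$, and complex numbers $a_{\alpha,\beta}$ such that, with $z'=(z_1,z_2)$ and $r=R\circ\Psi$: (i) as $z\to0$, $$r(z)=\operatorname{Re} z_3+\sum_{\substack{m\le|\alpha|+|\beta|\le\eta\\ |\alpha|>0,\ |\beta|>0}}a_{\alpha,\beta}\,z'^{\alpha}\bar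 z'^{\beta}+O\big(|z_3||z|+|z'|^{\eta+1}\big);$$ (ii) in these coordinates $V$ is the $z_1$-axis to order $\eta$: near $0$ it is given by $z_2=0$, $z_3=g(z_1)$ for some $g$ holomorphic near $0$ with $g(t)=O(|t|^\eta)$; moreover $|r(t,0,0)|\lesssim|t|^\eta$ as $t\to 0$ in $\mathbb C$; (iii) $a_{\alpha,\beta}\neq0$ for some $\alpha=(0,\alpha_2)$, $\beta=(0,\beta_2)$ with $\alpha_2+\beta_2=m$, $\alpha_2>0$, $\beta_2>0$. -/

import Mathlib

open scoped Topology ContDiff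

/-- Order of vanishing at the origin of a real function `g`, as an element of `ℕ∞`:
the supremum of all `k` with `g(x) = O(‖x‖ ^ k)` as `x → 0`. For a smooth `g` this is the lowest
degree of a nonzero term of the Taylor expansion of `g` at `0` (and `⊤` if all of them vanish). -/
noncomputable def vanishingOrder {E : Type*} [NormedAddCommGroup E] (g : E → ℝ) : ℕ∞ :=
  ⨆ (k : ℕ) (_ : g =O[𝓝 0] fun x => ‖x‖ ^ k), (k : ℕ∞)

/-- `φ` parametrizes, near the parameter value `0`, a smooth complex submanifold germ through `p`:
it is holomorphic near `0`, maps `0` to `p`, and its complex derivative at `0` is injective. -/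
structure IsSubmanifoldParam {E F : Type*} [NormedAddCommGroup E] [NormedSpace ℂ E]
    [NormedAddCommGroup F] [NormedSpace ℂ F] (φ : E → F) (p : F) : Prop where
  analyticAt : AnalyticAt ℂ φ 0
  map_zero : φ 0 = p
  injective_fderiv : Function.Injective (fderiv ℂ φ 0)

/-- The Bloom-Graham type at `p ∈ ℂ ^ (n + 1)` of the hypersurface with defining function `R`:
the maximal order of contact at `p` with smooth complex submanifolds of dimension `n`. -/
noncomputable def bloomGrahamType {n : ℕ} (R : EuclideanSpace ℂ (Fin (n + 1)) → ℝ)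
    (p : EuclideanSpace ℂ (Fin (n + 1))) : ℕ∞ :=
  ⨆ (φ : EuclideanSpace ℂ (Fin n) → EuclideanSpace ℂ (Fin (n + 1)))
    (_ : IsSubmanifoldParam φ p), vanishingOrder (fun ζ => R (φ ζ))

/-- `V` is, near `p`, a smooth one-dimensional complex analytic variety through `p`: some
holomorphic `γ` with `γ 0 = p`, `γ' 0 ≠ 0` (injectivity of the derivative) parametrizes `V` near
`p`; the equality of filters says that the images under `γ` of the small neighbourhoods of `0` are
exactly the small neighbourhoods of `p` in `V`. -/
def IsSmoothCurveAt {n : ℕ} (V : Set (EuclideanSpace ℂ (Fin n)))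
    (p : EuclideanSpace ℂ (Fin n)) : Prop :=
  ∃ γ : ℂ → EuclideanSpace ℂ (Fin n),
    IsSubmanifoldParam γ p ∧ Filter.map γ (𝓝 0) = 𝓝[V] p

/-- `Ω` is a smoothly bounded domain with the smooth defining function `R`. -/
structure IsSmoothlyBoundedDomain {n : ℕ} (Ω : Set (EuclideanSpace ℂ (Fin n)))
    (R : EuclideanSpace ℂ (Fin n) → ℝ) : Prop where
  eq_sublevel : Ω = {w | R w < 0}
  isConnected : IsConnected Ω
  isBounded : Bornology.IsBounded Ω
  contDiff : ContDiff ℝ ∞ R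
  fderiv_ne_zero : ∀ p ∈ frontier Ω, fderiv ℝ R p ≠ 0

/-- The Levi form `∑ (∂²R / ∂w_j ∂w̄_k)(p) ξ_j ξ̄_k`, written through the real second derivative. -/
noncomputable def leviForm {n : ℕ} (R : EuclideanSpace ℂ (Fin n) → ℝ)
    (p ξ : EuclideanSpace ℂ (Fin n)) : ℝ :=
  (1 / 4) * (fderiv ℝ (fderiv ℝ R) p ξ ξ +
    fderiv ℝ (fderiv ℝ R) p (Complex.I • ξ) (Complex.I • ξ))

/-- (Levi) pseudoconvexity of `Ω` with defining function `R`: at every boundary point the Levi form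
is nonnegative on complex tangent vectors, that is, on the `ξ` with `∑ (∂R / ∂w_j)(p) ξ_j = 0`
(equivalently, both `ξ` and `i ξ` are tangent to the boundary). -/
def IsLeviPseudoconvex {n : ℕ} (Ω : Set (EuclideanSpace ℂ (Fin n)))
    (R : EuclideanSpace ℂ (Fin n) → ℝ) : Prop :=
  ∀ p ∈ frontier Ω, ∀ ξ : EuclideanSpace ℂ (Fin n),
    fderiv ℝ R p ξ = 0 → fderiv ℝ R p (Complex.I • ξ) = 0 → 0 ≤ leviForm R p ξ

/-- `w = Ψ z` is a holomorphic coordinate system about the origin: `Ψ` is holomorphic near `0`, fixes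
`0`, and has an invertible complex derivative at `0`. -/
structure IsHolomorphicCoordinates {n : ℕ}
    (Ψ : EuclideanSpace ℂ (Fin n) → EuclideanSpace ℂ (Fin n)) : Prop where
  analyticAt : AnalyticAt ℂ Ψ 0
  map_zero : Ψ 0 = 0
  bijective_fderiv : Function.Bijective (fderiv ℂ Ψ 0)

/-- `z' = (z₁, z₂)` for `z = (z₁, z₂, z₃)`. -/
noncomputable def firstTwo (z : EuclideanSpace ℂ (Fin 3)) : EuclideanSpace ℂ (Fin 2) :=
  !₂[z 0, z 1]

/-- The length `|α| = α₁ + α₂` of a multi-index. -/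
def multiLength (α : Fin 2 → ℕ) : ℕ := ∑ i, α i

/-- The monomial `u ^ α * ū ^ β` for `u ∈ ℂ²`. -/
noncomputable def mixedMonomial (α β : Fin 2 → ℕ) (u : EuclideanSpace ℂ (Fin 2)) : ℂ :=
  (∏ i, u i ^ α i) * ∏ i, (starRingEnd ℂ (u i)) ^ β i

/-- The pairs `(α, β)` of multi-indices with `|α|, |β| > 0` and `m ≤ |α| + |β| ≤ η`. -/
def mixedIndices (m η : ℕ) : Finset ((Fin 2 → ℕ) × (Fin 2 → ℕ)) :=
  ((Fintype.piFinset fun _ => Finset.range (η + 1)) ×ˢ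
    (Fintype.piFinset fun _ => Finset.range (η + 1))).filter fun x =>
      0 < multiLength x.1 ∧ 0 < multiLength x.2 ∧
        m ≤ multiLength x.1 + multiLength x.2 ∧ multiLength x.1 + multiLength x.2 ≤ η

theorem mem_mixedIndices (m η : ℕ) (x : (Fin 2 → ℕ) × (Fin 2 → ℕ)) :
    x ∈ mixedIndices m η ↔ 0 < multiLength x.1 ∧ 0 < multiLength x.2 ∧
      m ≤ multiLength x.1 + multiLength x.2 ∧ multiLength x.1 + multiLength x.2 ≤ η := by
  simp only [mixedIndices, multiLength, Finset.mem_filter, Finset.mem_product,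
    Fintype.mem_piFinset, Finset.mem_range, Fin.sum_univ_two, Fin.forall_fin_two]
  omega

/-!
In coordinates `(u, s)` with `R = Re s` to first order, replacing `s` by `s + h u`, with `h` a
polynomial, removes the pure terms of the Taylor series of `R (u, 0)` up to any prescribed order.
Once they are gone, `s = 0` is optimal among the graphs `s = h u`: the leading term of `h` would
contribute the pluriharmonic term `Re (h u)`, which no mixed term can cancel. Applied to complex
hypersurfaces, this shows that the Bloom–Graham type is the order of vanishing of `R (u, 0)`;
applied to `V`, straightened to a graph over the `u₁`-axis, it bounds that graph and `R (t, 0, 0)`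
by `|t| ^ η`. A linear shear of `u` fixing the `u₁`-axis finally makes a nonzero component of
degree `m` nonzero on the `u₂`-axis.
-/

open Finset.HasAntidiagonal

theorem add_pow_le_iSup_pow_mul_pow {R A : Type*} [CommSemiring R] [CommSemiring A] [Algebra R A]
    (M N : Submodule R A) (k : ℕ) :
    (M + N) ^ k ≤ ⨆ x ∈ antidiagonal k, M ^ x.1 * N ^ x.2 := by
  rw [(Commute.all M N).add_pow']
  refine Finset.sum_induction _ (fun S => S ≤ _) (fun _ _ => sup_le) bot_le fun x hx => ?_
  have hk := mem_antidiagonal.1 hx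
  rw [nsmul_eq_self (Nat.choose_pos (by omega)).ne']
  exact fun F hF => Submodule.mem_iSup_of_mem x (Submodule.mem_iSup_of_mem hx hF)

theorem multilinear_diagonal_mem_pow {K W : Type*} [Field K] [Algebra K ℂ] [AddCommGroup W]
    [Module K W] [FiniteDimensional K W] {S : Submodule ℂ (W → ℂ)} (hS : ∀ ℓ : W →ₗ[K] ℂ, ⇑ℓ ∈ S)
    {k : ℕ} (A : MultilinearMap K (fun _ : Fin k => W) ℂ) : (fun u => A fun _ => u) ∈ S ^ k := by
  induction k with
  | zero =>
    have h (u : W) : (A fun _ => u) = A 0 := congrArg A (funext fun i => i.elim0)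
    simp only [pow_zero, h]
    exact Submodule.algebraMap_mem (A 0)
  | succ k ih =>
    let b := Module.finBasis K W
    have hcons (u : W) : (A fun _ => u) = A.curryLeft u fun _ => u := by
      rw [MultilinearMap.curryLeft_apply]
      exact congrArg A (Fin.cons_self_tail fun _ => u).symm
    have hA : (fun u => A fun _ => u) =
        ∑ i, ⇑((Algebra.linearMap K ℂ).comp (b.coord i)) *
          fun u => A.curryLeft (b i) fun _ => u := by
      funext u
      rw [hcons]
      conv_lhs => enter [1]; rw [← b.sum_repr u]
      simp only [map_sum, map_smul, sum_apply, smul_apply,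
        Finset.sum_apply, Pi.mul_apply, LinearMap.comp_apply, Algebra.linearMap_apply,
        Module.Basis.coord_apply, Algebra.smul_def]
    rw [hA, pow_succ']
    exact Submodule.sum_mem _ fun i _ => Submodule.mul_mem_mul (hS _) (ih _)

section Bihomogeneous

variable {E E' : Type*} [NormedAddCommGroup E] [NormedSpace ℂ E]
  [NormedAddCommGroup E'] [NormedSpace ℂ E']

variable (E) in
/-- The continuous `ℂ`-linear functionals on `E`, inside the algebra of functions `E → ℂ`. -/
def linearForms : Submodule ℂ (E → ℂ) where
  carrier := Set.range fun ℓ : E →L[ℂ] ℂ => ⇑ℓ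
  zero_mem' := ⟨0, rfl⟩
  add_mem' := by
    rintro _ _ ⟨ℓ, rfl⟩ ⟨ℓ', rfl⟩
    exact ⟨ℓ + ℓ', rfl⟩
  smul_mem' := by
    rintro c _ ⟨ℓ, rfl⟩
    exact ⟨c • ℓ, rfl⟩

variable (E) in
/-- The complex conjugates of the continuous `ℂ`-linear functionals on `E`. -/
def conjLinearForms : Submodule ℂ (E → ℂ) :=
  (linearForms E).map (starLinearEquiv ℂ).toLinearMap

variable (E) in
/-- The functions on `E` that are homogeneous polynomials of degree `p` in the coordinates and of
degree `q` in their conjugates: the span of the products of `p` linear forms and `q` conjugates of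
linear forms. -/
def bihomogeneous (p q : ℕ) : Submodule ℂ (E → ℂ) :=
  linearForms E ^ p * conjLinearForms E ^ q

theorem const_mem_bihomogeneous (c : ℂ) : (fun _ => c) ∈ bihomogeneous E 0 0 := by
  rw [bihomogeneous, pow_zero, pow_zero, mul_one]
  exact Submodule.algebraMap_mem c

theorem linear_mul_mem_bihomogeneous (ℓ : E →L[ℂ] ℂ) {p q : ℕ} {F : E → ℂ}
    (hF : F ∈ bihomogeneous E p q) : (fun u => ℓ u * F u) ∈ bihomogeneous E (p + 1) q := by
  rw [bihomogeneous, pow_succ', mul_assoc]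
  exact Submodule.mul_mem_mul ⟨ℓ, rfl⟩ hF

theorem conj_mul_mem_bihomogeneous (ℓ : E →L[ℂ] ℂ) {p q : ℕ} {F : E → ℂ}
    (hF : F ∈ bihomogeneous E p q) :
    (fun u => starRingEnd ℂ (ℓ u) * F u) ∈ bihomogeneous E p (q + 1) := by
  rw [bihomogeneous, pow_succ', mul_left_comm]
  exact Submodule.mul_mem_mul ⟨ℓ, ⟨ℓ, rfl⟩, rfl⟩ hF

@[elab_as_elim]
theorem bihomogeneous_induction
    {C : ∀ (p q : ℕ) (F : E → ℂ), F ∈ bihomogeneous E p q → Prop}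
    (const : ∀ c, C 0 0 _ (const_mem_bihomogeneous c))
    (linear_mul : ∀ ℓ {p q F} (hF : F ∈ bihomogeneous E p q), C p q F hF →
      C (p + 1) q _ (linear_mul_mem_bihomogeneous ℓ hF))
    (conj_mul : ∀ ℓ {p q F} (hF : F ∈ bihomogeneous E p q), C p q F hF →
      C p (q + 1) _ (conj_mul_mem_bihomogeneous ℓ hF))
    (add : ∀ {p q F G} (hF : F ∈ bihomogeneous E p q) (hG : G ∈ bihomogeneous E p q),
      C p q F hF → C p q G hG → C p q (F + G) (Submodule.add_mem _ hF hG))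
    {p q : ℕ} {F : E → ℂ} (hF : F ∈ bihomogeneous E p q) : C p q F hF := by
  have hconj {q : ℕ} {G : E → ℂ} (hG : G ∈ conjLinearForms E ^ q) : ∃ h, C 0 q G h := by
    induction hG using Submodule.pow_induction_on_left' with
    | algebraMap c => exact ⟨_, const c⟩
    | add F G _ _ _ hF hG => exact ⟨_, add _ _ hF.2 hG.2⟩
    | mem_mul ℓ hℓ _ _ _ hF =>
      obtain ⟨_, ⟨ℓ, rfl⟩, rfl⟩ := hℓ
      exact ⟨_, conj_mul ℓ _ hF.2⟩
  suffices h : ∃ h, C p q F h from h.2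
  induction hF using Submodule.mul_induction_on' with
  | add F _ G _ hF hG => exact ⟨_, add _ _ hF.2 hG.2⟩
  | mem_mul_mem F hF G hG =>
    induction hF using Submodule.pow_induction_on_left' with
    | algebraMap c =>
      rw [← Algebra.smul_def]
      exact hconj (Submodule.smul_mem _ c hG)
    | add F F' _ _ _ hF hF' => exact add_mul F F' G ▸ ⟨_, add _ _ hF.2 hF'.2⟩
    | mem_mul ℓ hℓ _ F _ hF =>
      obtain ⟨ℓ, rfl⟩ := hℓ
      exact mul_assoc (⇑ℓ) F G ▸ ⟨_, linear_mul ℓ _ hF.2⟩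

theorem conj_mem_bihomogeneous {p q : ℕ} {F : E → ℂ} (hF : F ∈ bihomogeneous E p q) :
    (fun u => starRingEnd ℂ (F u)) ∈ bihomogeneous E q p := by
  induction hF using bihomogeneous_induction with
  | const c => exact const_mem_bihomogeneous _
  | linear_mul ℓ _ hF => simpa only [map_mul] using conj_mul_mem_bihomogeneous ℓ hF
  | conj_mul ℓ _ hF =>
    simpa only [map_mul, Complex.conj_conj] using linear_mul_mem_bihomogeneous ℓ hF
  | add _ _ hF hG =>
    simp only [Pi.add_apply, map_add]
    exact Submodule.add_mem _ hF hG

theorem comp_clm_mem_bihomogeneous {p q : ℕ} {F : E → ℂ} (hF : F ∈ bihomogeneous E p q)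
    (T : E' →L[ℂ] E) : F ∘ T ∈ bihomogeneous E' p q := by
  induction hF using bihomogeneous_induction with
  | const c => exact const_mem_bihomogeneous c
  | linear_mul ℓ _ hF => exact linear_mul_mem_bihomogeneous (ℓ.comp T) hF
  | conj_mul ℓ _ hF => exact conj_mul_mem_bihomogeneous (ℓ.comp T) hF
  | add _ _ hF hG => exact Submodule.add_mem _ hF hG

theorem bihomogeneous_smul {p q : ℕ} {F : E → ℂ} (hF : F ∈ bihomogeneous E p q) (c : ℂ) (u : E) :
    F (c • u) = c ^ p * starRingEnd ℂ c ^ q * F u := by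
  induction hF using bihomogeneous_induction with
  | const c => simp
  | linear_mul ℓ _ hF =>
    simp only [hF, map_smul, smul_eq_mul]
    ring
  | conj_mul ℓ _ hF =>
    simp only [hF, map_smul, smul_eq_mul, map_mul]
    ring
  | add _ _ hF hG =>
    rw [Pi.add_apply, Pi.add_apply, hF, hG]
    ring

theorem contDiff_of_mem_bihomogeneous {p q : ℕ} {F : E → ℂ} (hF : F ∈ bihomogeneous E p q) :
    ContDiff ℝ ∞ F := by
  induction hF using bihomogeneous_induction with
  | const c => exact contDiff_const
  | linear_mul ℓ _ hF => exact (ℓ.restrictScalars ℝ).contDiff.mul hF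
  | conj_mul ℓ _ hF => exact (Complex.conjCLE.contDiff.comp (ℓ.restrictScalars ℝ).contDiff).mul hF
  | add _ _ hF hG => exact hF.add hG

theorem analyticAt_of_mem_bihomogeneous_zero {p : ℕ} {F : E → ℂ} (hF : F ∈ bihomogeneous E p 0)
    (u : E) : AnalyticAt ℂ F u := by
  generalize hq : (0 : ℕ) = q at hF
  induction hF using bihomogeneous_induction with
  | const c => exact analyticAt_const
  | linear_mul ℓ _ hF => exact (ℓ.analyticAt u).mul (hF hq)
  | conj_mul => exact absurd hq (Nat.succ_ne_zero _).symm
  | add _ _ hF hG => exact (hF hq).add (hG hq)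

theorem isBigO_of_mem_bihomogeneous {p q : ℕ} {F : E → ℂ} (hF : F ∈ bihomogeneous E p q) :
    F =O[𝓝 0] fun u => ‖u‖ ^ (p + q) := by
  induction hF using bihomogeneous_induction with
  | const c => exact Asymptotics.isBigO_const_const c one_ne_zero _
  | linear_mul ℓ _ hF =>
    refine (((ℓ.isBigO_id _).norm_right).mul hF).congr_right fun u => ?_
    ring
  | conj_mul ℓ _ hF =>
    have hℓ : (fun u => starRingEnd ℂ (ℓ u)) =O[𝓝 0] fun u => ‖u‖ :=
      (((Complex.conjCLE : ℂ →L[ℝ] ℂ).comp (ℓ.restrictScalars ℝ)).isBigO_id _).norm_right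
    refine (hℓ.mul hF).congr_right fun u => ?_
    ring
  | add _ _ hF hG => exact hF.add hG

theorem ofReal_mem_linearForms_add_conjLinearForms (ℓ : E →L[ℝ] ℝ) :
    (fun u => (ℓ u : ℂ)) ∈ linearForms E + conjLinearForms E := by
  have h : (fun u => (ℓ u : ℂ)) = (1 / 2 : ℂ) • (⇑(StrongDual.extendRCLike ℓ : StrongDual ℂ E) +
      star ⇑(StrongDual.extendRCLike ℓ : StrongDual ℂ E)) := by
    funext u
    simp only [Pi.smul_apply, Pi.add_apply, Pi.star_apply, smul_eq_mul, RCLike.star_def,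
      Complex.add_conj]
    have := StrongDual.re_extendRCLike_apply (𝕜 := ℂ) ℓ u
    rw [RCLike.re_eq_complex_re] at this
    rw [this]
    push_cast
    ring
  rw [h]
  exact Submodule.smul_mem _ _ (Submodule.add_mem_sup ⟨_, rfl⟩ ⟨_, ⟨_, rfl⟩, rfl⟩)

theorem real_linear_mem_linearForms_add_conjLinearForms [FiniteDimensional ℂ E]
    (ℓ : E →ₗ[ℝ] ℂ) : ⇑ℓ ∈ linearForms E + conjLinearForms E := by
  have : FiniteDimensional ℝ E := FiniteDimensional.complexToReal E
  have h := Submodule.add_mem _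
    (ofReal_mem_linearForms_add_conjLinearForms (Complex.reCLM.comp ℓ.toContinuousLinearMap))
    (Submodule.smul_mem _ Complex.I
      (ofReal_mem_linearForms_add_conjLinearForms (Complex.imCLM.comp ℓ.toContinuousLinearMap)))
  convert h using 1
  funext u
  change ℓ u = ((ℓ u).re : ℂ) + Complex.I * (ℓ u).im
  rw [mul_comm, Complex.re_add_im]

theorem real_multilinear_diagonal_mem_bihomogeneous [FiniteDimensional ℂ E] {k : ℕ}
    (A : MultilinearMap ℝ (fun _ : Fin k => E) ℂ) :
    (fun u => A fun _ => u) ∈ ⨆ x ∈ antidiagonal k, bihomogeneous E x.1 x.2 :=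
  have : FiniteDimensional ℝ E := FiniteDimensional.complexToReal E
  add_pow_le_iSup_pow_mul_pow _ _ k
    (multilinear_diagonal_mem_pow real_linear_mem_linearForms_add_conjLinearForms A)

theorem complex_multilinear_diagonal_mem_bihomogeneous [FiniteDimensional ℂ E] {k : ℕ}
    (A : MultilinearMap ℂ (fun _ : Fin k => E) ℂ) :
    (fun u => A fun _ => u) ∈ bihomogeneous E k 0 := by
  rw [bihomogeneous, pow_zero, mul_one]
  exact multilinear_diagonal_mem_pow (S := linearForms E)
    (fun ℓ => ⟨ℓ.toContinuousLinearMap, rfl⟩) A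

end Bihomogeneous

theorem isBigO_norm_pow_of_le {E : Type*} [NormedAddCommGroup E] {a b : ℕ} (h : a ≤ b) :
    (fun u : E => ‖u‖ ^ b) =O[𝓝 0] fun u => ‖u‖ ^ a :=
  .of_norm_eventuallyLE <| by
    filter_upwards [Metric.ball_mem_nhds (0 : E) one_pos] with u hu
    rw [norm_pow, norm_norm]
    exact pow_le_pow_of_le_one (norm_nonneg u) (mem_ball_zero_iff.1 hu).le h

theorem eq_zero_of_homogeneous_of_isBigO {E : Type*} [NormedAddCommGroup E] [NormedSpace ℝ E]
    {S : E → ℂ} {d : ℕ} (hS : ∀ (t : ℝ) (u : E), S (t • u) = (t : ℂ) ^ d * S u)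
    (hO : S =O[𝓝 0] fun u => ‖u‖ ^ (d + 1)) (u : E) : S u = 0 := by
  let A := ContinuousMultilinearMap.mkPiRing ℝ (Fin d) (S u)
  have hline : Filter.Tendsto (fun t : ℝ => t • u) (𝓝 0) (𝓝 0) :=
    Continuous.tendsto' (by fun_prop) _ _ (zero_smul ℝ u)
  have hA : (fun t : ℝ => A fun _ => t) =O[𝓝 0] fun t => ‖t‖ ^ (d + 1) := by
    have h : (fun t : ℝ => ‖t • u‖ ^ (d + 1)) =O[𝓝 0] fun t => ‖t‖ ^ (d + 1) :=
      .of_bound (‖u‖ ^ (d + 1)) (.of_forall fun t => by simp [norm_smul, mul_pow, mul_comm])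
    exact ((hO.comp_tendsto hline).trans h).congr_left fun t => by simp [A, hS]
  simpa [A] using hA.continuousMultilinearMap_apply_eq_zero 1

theorem isBigO_sub_taylor {E F : Type*} [NormedAddCommGroup E] [NormedSpace ℝ E]
    [NormedAddCommGroup F] [NormedSpace ℝ F] [CompleteSpace F] {f : E → F} {n : ℕ}
    (hf : ContDiffAt ℝ (n + 1) f 0) :
    (fun x => f x - ∑ k ∈ Finset.range (n + 1),
      (k.factorial : ℝ)⁻¹ • iteratedFDeriv ℝ k f 0 fun _ => x) =O[𝓝 0]
        fun x => ‖x‖ ^ (n + 1) := by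
  let D := iteratedFDeriv ℝ (n + 1) f
  have hD : ContinuousAt D 0 :=
    (hf.iteratedFDeriv_right (i := n + 1) (m := 0) (by simp)).continuousAt
  have hsmooth : ∀ᶠ y in 𝓝 (0 : E), ContDiffAt ℝ (n + 1) f y :=
    hf.eventually (by exact_mod_cast WithTop.coe_ne_top)
  have hbound : ∀ᶠ y in 𝓝 (0 : E), ‖D y‖ < ‖D 0‖ + 1 :=
    hD.norm.eventually_lt continuousAt_const (lt_add_one _)
  obtain ⟨δ, hδ, hball⟩ := Metric.eventually_nhds_iff_ball.1 (hsmooth.and hbound)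
  refine .of_bound ((n.factorial : ℝ)⁻¹ * (‖D 0‖ + 1)) ?_
  filter_upwards [Metric.ball_mem_nhds (0 : E) hδ] with x hx
  have hsegment : ∀ t ∈ Set.Icc (0 : ℝ) 1, (0 : E) + t • x ∈ Metric.ball (0 : E) δ := fun t ht => by
    rw [zero_add]
    exact ((convex_ball 0 δ).starConvex (Metric.mem_ball_self hδ)).smul_mem hx ht.1 ht.2
  have htaylor := map_add_eq_sum_add_integral_iteratedFDeriv (f := f) (x := 0) (y := x) (n := n)
    fun t ht => (hball _ (hsegment t ht)).1
  rw [zero_add] at htaylor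
  rw [htaylor, add_sub_cancel_left, norm_smul, norm_pow, norm_norm, mul_assoc,
    Real.norm_of_nonneg (by positivity)]
  gcongr
  refine (intervalIntegral.norm_integral_le_of_norm_le_const
    (C := (‖D 0‖ + 1) * ‖x‖ ^ (n + 1)) fun t ht => ?_).trans (by simp)
  rw [Set.uIoc_of_le zero_le_one] at ht
  have hDt := (hball _ (hsegment t ⟨ht.1.le, ht.2⟩)).2.le
  rw [norm_smul, norm_pow, Real.norm_of_nonneg (sub_nonneg.2 ht.2)]
  calc (1 - t) ^ n * ‖D (0 + t • x) fun _ => x‖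
      ≤ 1 * (‖D (0 + t • x)‖ * ‖x‖ ^ (n + 1)) := by
        gcongr
        · exact pow_le_one₀ (sub_nonneg.2 ht.2) (sub_le_self 1 ht.1.le)
        · simpa using (D (0 + t • x)).le_opNorm fun _ => x
    _ ≤ (‖D 0‖ + 1) * ‖x‖ ^ (n + 1) := by
        rw [one_mul]
        gcongr

section BigradedTaylorSeries

variable {E E' : Type*} [NormedAddCommGroup E] [NormedSpace ℂ E]
  [NormedAddCommGroup E'] [NormedSpace ℂ E']

theorem eq_zero_of_sum_antidiagonal_eq_zero {k : ℕ} {F : ℕ × ℕ → E → ℂ}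
    (hF : ∀ x, F x ∈ bihomogeneous E x.1 x.2) (h : ∀ u, ∑ x ∈ antidiagonal k, F x u = 0)
    {x : ℕ × ℕ} (hx : x ∈ antidiagonal k) : F x = 0 := by
  funext u
  -- On the circle `z ^ k * (z ^ p * z̄ ^ q) = z ^ (2 * p)` for `p + q = k`.
  let P : Polynomial ℂ := ∑ y ∈ antidiagonal k, Polynomial.monomial (2 * y.1) (F y u)
  have hroot : Metric.sphere (0 : ℂ) 1 ⊆ {z | P.IsRoot z} := by
    intro z hz
    have hz1 : z * starRingEnd ℂ z = 1 := by
      rw [Complex.mul_conj, Complex.normSq_eq_norm_sq, mem_sphere_zero_iff_norm.1 hz]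
      simp
    have hzk : z ^ k * ∑ y ∈ antidiagonal k, F y (z • u) = 0 := by rw [h, mul_zero]
    rw [Finset.mul_sum] at hzk
    rw [Set.mem_ofPred_eq, Polynomial.IsRoot.def, Polynomial.eval_finsetSum, ← hzk]
    refine Finset.sum_congr rfl fun y hy => ?_
    rw [Polynomial.eval_monomial, bihomogeneous_smul (hF y), ← mem_antidiagonal.1 hy]
    have hzy : z ^ y.2 * starRingEnd ℂ z ^ y.2 = 1 := by rw [← mul_pow, hz1, one_pow]
    linear_combination -(F y u * z ^ (2 * y.1)) * hzy
  have hP : P = 0 := P.eq_zero_of_infinite_isRoot <| Set.Infinite.mono hroot <|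
    (isPreconnected_sphere (by simp [Complex.rank_real_complex]) 0 1).infinite_of_nontrivial
      ⟨1, by simp, -1, by simp, by norm_num⟩
  have hcoeff := congrArg (Polynomial.coeff · (2 * x.1)) hP
  simp only [P, Polynomial.finsetSum_coeff, Polynomial.coeff_monomial, Polynomial.coeff_zero]
    at hcoeff
  rw [Finset.sum_eq_single_of_mem x hx, if_pos rfl] at hcoeff
  · exact hcoeff
  · intro y hy hyx
    refine if_neg fun hxy => hyx (Prod.ext (by omega) ?_)
    have := mem_antidiagonal.1 hx
    have := mem_antidiagonal.1 hy
    omega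

/-- The sum of the components of total degree less than `n` of a family of functions indexed by
bidegrees. -/
def bigradedPartialSum (F : ℕ × ℕ → E → ℂ) (n : ℕ) (u : E) : ℂ :=
  ∑ k ∈ Finset.range n, ∑ x ∈ antidiagonal k, F x u

/-- `F (p, q)` is the component of degree `p` in the coordinates and `q` in their conjugates of the
Taylor series of `f` at the origin. The series need not converge to `f`: only its partial sums are
compared with `f`. -/
structure HasBigradedTaylorSeries (f : E → ℂ) (F : ℕ × ℕ → E → ℂ) : Prop where
  mem_bihomogeneous : ∀ x, F x ∈ bihomogeneous E x.1 x.2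
  isBigO_sub_partialSum : ∀ n,
    (fun u => f u - bigradedPartialSum F n u) =O[𝓝 0] fun u => ‖u‖ ^ n

theorem eq_zero_of_isBigO_sum_antidiagonal {F : ℕ × ℕ → E → ℂ}
    (hF : ∀ x, F x ∈ bihomogeneous E x.1 x.2) {k : ℕ}
    (h : (fun u => ∑ x ∈ antidiagonal k, F x u) =O[𝓝 0] fun u => ‖u‖ ^ (k + 1))
    {x : ℕ × ℕ} (hx : x ∈ antidiagonal k) : F x = 0 := by
  refine eq_zero_of_sum_antidiagonal_eq_zero hF (eq_zero_of_homogeneous_of_isBigO ?_ h) hx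
  intro t u
  rw [Finset.mul_sum]
  refine Finset.sum_congr rfl fun y hy => ?_
  rw [← Complex.coe_smul, bihomogeneous_smul (hF y), Complex.conj_ofReal, ← pow_add,
    mem_antidiagonal.1 hy]

theorem bigradedPartialSum_eq_zero {X : Type*} {F : ℕ × ℕ → X → ℂ} {n : ℕ}
    (hF : ∀ x, x.1 + x.2 < n → F x = 0) : bigradedPartialSum F n = 0 := by
  funext u
  refine Finset.sum_eq_zero fun k hk => Finset.sum_eq_zero fun x hx => ?_
  rw [hF x (mem_antidiagonal.1 hx ▸ Finset.mem_range.1 hk), Pi.zero_apply]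

namespace HasBigradedTaylorSeries

variable {f g : E → ℂ} {F G : ℕ × ℕ → E → ℂ}

theorem isBigO_iff (hf : HasBigradedTaylorSeries f F) {n : ℕ} :
    (f =O[𝓝 0] fun u => ‖u‖ ^ n) ↔ ∀ x, x.1 + x.2 < n → F x = 0 := by
  refine ⟨fun h x hx => ?_, fun h => ?_⟩
  · obtain ⟨k, hk⟩ : ∃ k, x.1 + x.2 = k := ⟨_, rfl⟩
    induction k using Nat.strong_induction_on generalizing x with
    | _ k ih =>
      have hlow : bigradedPartialSum F k = 0 :=
        bigradedPartialSum_eq_zero fun y hy => ih _ hy y (by omega) rfl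
      refine eq_zero_of_isBigO_sum_antidiagonal hf.mem_bihomogeneous (k := k) ?_
        (mem_antidiagonal.2 hk)
      refine ((h.trans (isBigO_norm_pow_of_le (by omega))).sub
        (hf.isBigO_sub_partialSum (k + 1))).congr_left fun u => ?_
      have hu := congrFun hlow u
      rw [bigradedPartialSum, Pi.zero_apply] at hu
      rw [sub_sub_cancel, bigradedPartialSum, Finset.sum_range_succ, hu, zero_add]
  · simpa only [bigradedPartialSum_eq_zero h, Pi.zero_apply, sub_zero] using
      hf.isBigO_sub_partialSum n

theorem add (hf : HasBigradedTaylorSeries f F) (hg : HasBigradedTaylorSeries g G) :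
    HasBigradedTaylorSeries (f + g) (F + G) where
  mem_bihomogeneous x := Submodule.add_mem _ (hf.mem_bihomogeneous x) (hg.mem_bihomogeneous x)
  isBigO_sub_partialSum n := by
    refine ((hf.isBigO_sub_partialSum n).add (hg.isBigO_sub_partialSum n)).congr_left fun u => ?_
    simp only [bigradedPartialSum, Pi.add_apply, Finset.sum_add_distrib]
    ring

theorem const_smul (hf : HasBigradedTaylorSeries f F) (c : ℂ) :
    HasBigradedTaylorSeries (c • f) (c • F) where
  mem_bihomogeneous x := Submodule.smul_mem _ c (hf.mem_bihomogeneous x)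
  isBigO_sub_partialSum n := by
    refine ((hf.isBigO_sub_partialSum n).const_smul_left c).congr_left fun u => ?_
    simp only [bigradedPartialSum, Pi.smul_apply, Finset.smul_sum, smul_sub]

theorem sub (hf : HasBigradedTaylorSeries f F) (hg : HasBigradedTaylorSeries g G) :
    HasBigradedTaylorSeries (f - g) (F - G) := by
  simpa only [neg_one_smul, ← sub_eq_add_neg] using hf.add (hg.const_smul (-1))

theorem conj (hf : HasBigradedTaylorSeries f F) :
    HasBigradedTaylorSeries (fun u => starRingEnd ℂ (f u))
      fun x u => starRingEnd ℂ (F x.swap u) where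
  mem_bihomogeneous x := conj_mem_bihomogeneous (hf.mem_bihomogeneous x.swap)
  isBigO_sub_partialSum n := by
    refine (Asymptotics.isBigO_of_le _ fun u => ?_).trans (hf.isBigO_sub_partialSum n)
    simp only [bigradedPartialSum]
    rw [← RCLike.norm_conj (f u - _), map_sub, map_sum]
    simp only [map_sum, le_rfl,
      Finset.Nat.sum_antidiagonal_swap (f := fun x => starRingEnd ℂ (F x u))]

theorem comp_clm (hf : HasBigradedTaylorSeries f F) (T : E' →L[ℂ] E) :
    HasBigradedTaylorSeries (f ∘ T) fun x => F x ∘ T where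
  mem_bihomogeneous x := comp_clm_mem_bihomogeneous (hf.mem_bihomogeneous x) T
  isBigO_sub_partialSum n :=
    ((hf.isBigO_sub_partialSum n).comp_tendsto (T.continuous.tendsto' 0 0 (map_zero T))).trans
      ((T.isBigO_id (𝓝 0)).norm_norm.pow n)

theorem unique (hF : HasBigradedTaylorSeries f F) (hG : HasBigradedTaylorSeries f G) : F = G := by
  funext x
  have h := hF.sub hG
  rw [sub_self] at h
  exact sub_eq_zero.1 (h.isBigO_iff.1 (Asymptotics.isBigO_zero _ _) x (Nat.lt_succ_self _))

theorem conj_eq_swap {r : E → ℝ} (hF : HasBigradedTaylorSeries (fun u => (r u : ℂ)) F)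
    (x : ℕ × ℕ) (u : E) : starRingEnd ℂ (F x u) = F x.swap u := by
  have h := hF.conj
  simp only [Complex.conj_ofReal] at h
  exact congrFun (congrFun (h.unique hF) x.swap) u

theorem single {p q : ℕ} {S : E → ℂ} (hS : S ∈ bihomogeneous E p q) :
    HasBigradedTaylorSeries S (Pi.single (p, q) S) where
  mem_bihomogeneous x := by
    obtain rfl | hx := eq_or_ne x (p, q)
    · rwa [Pi.single_eq_same]
    · rw [Pi.single_eq_of_ne hx]
      exact Submodule.zero_mem _
  isBigO_sub_partialSum n := by
    by_cases hn : p + q < n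
    · have h (u : E) : bigradedPartialSum (Pi.single (p, q) S) n u = S u := by
        rw [bigradedPartialSum, Finset.sum_eq_single_of_mem _ (Finset.mem_range.2 hn),
          Finset.sum_eq_single_of_mem (p, q) (mem_antidiagonal.2 rfl), Pi.single_eq_same]
        · exact fun x _ hx => by rw [Pi.single_eq_of_ne hx, Pi.zero_apply]
        · refine fun k _ hk => Finset.sum_eq_zero fun x hx => ?_
          rw [Pi.single_eq_of_ne, Pi.zero_apply]
          rintro rfl
          exact hk (mem_antidiagonal.1 hx).symm
      simpa only [h, sub_self] using Asymptotics.isBigO_zero _ _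
    · rw [bigradedPartialSum_eq_zero]
      · simpa only [Pi.zero_apply, sub_zero] using
          (isBigO_of_mem_bihomogeneous hS).trans (isBigO_norm_pow_of_le (not_lt.1 hn))
      · intro x hx
        rw [Pi.single_eq_of_ne]
        rintro rfl
        exact hn hx

end HasBigradedTaylorSeries

theorem exists_hasBigradedTaylorSeries [FiniteDimensional ℂ E] {f : E → ℂ}
    (hf : ContDiffAt ℝ ∞ f 0) : ∃ F, HasBigradedTaylorSeries f F := by
  have hterm (k : ℕ) : ∃ μ : ∀ x : ℕ × ℕ, bihomogeneous E x.1 x.2,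
      ∑ x ∈ antidiagonal k, (μ x : E → ℂ) =
        fun u => (k.factorial : ℝ)⁻¹ • iteratedFDeriv ℝ k f 0 fun _ => u := by
    rw [← Submodule.mem_iSup_finset_iff_exists_sum]
    exact real_multilinear_diagonal_mem_bihomogeneous
      ((k.factorial : ℝ)⁻¹ • (iteratedFDeriv ℝ k f 0).toMultilinearMap)
  choose μ hμ using hterm
  have hsum (n : ℕ) (u : E) : bigradedPartialSum (fun x => μ (x.1 + x.2) x) n u =
      ∑ k ∈ Finset.range n, (k.factorial : ℝ)⁻¹ • iteratedFDeriv ℝ k f 0 fun _ => u := by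
    refine Finset.sum_congr rfl fun k _ => ?_
    rw [← congrFun (hμ k) u, Finset.sum_apply]
    exact Finset.sum_congr rfl fun x hx => by simp only [mem_antidiagonal.1 hx]
  refine ⟨fun x => μ (x.1 + x.2) x, fun x => (μ (x.1 + x.2) x).2, fun n => ?_⟩
  simp only [hsum]
  cases n with
  | zero =>
    simpa only [Finset.range_zero, Finset.sum_empty, sub_zero, pow_zero] using
      hf.continuousAt.isBigO_one ℝ
  | succ n => exact isBigO_sub_taylor (hf.of_le (by exact_mod_cast le_top))

theorem exists_hasBigradedTaylorSeries_of_analyticAt [FiniteDimensional ℂ E] {h : E → ℂ}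
    (hh : AnalyticAt ℂ h 0) :
    ∃ H, HasBigradedTaylorSeries h H ∧ ∀ x : ℕ × ℕ, x.2 ≠ 0 → H x = 0 := by
  obtain ⟨p, hp⟩ := hh
  refine ⟨fun x => if x.2 = 0 then fun u => p x.1 fun _ => u else 0, ⟨fun x => ?_, fun n => ?_⟩,
    fun x hx => if_neg hx⟩
  · obtain ⟨k, q⟩ := x
    obtain rfl | hq := eq_or_ne q 0
    · exact complex_multilinear_diagonal_mem_bihomogeneous (p k).toMultilinearMap
    · simpa only [if_neg hq] using Submodule.zero_mem (bihomogeneous E k q)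
  · refine (hp.isBigO_sub_partialSum_pow n).congr_left fun u => ?_
    rw [zero_add, FormalMultilinearSeries.partialSum, bigradedPartialSum]
    congr 1
    refine Finset.sum_congr rfl fun k _ => ?_
    rw [Finset.sum_eq_single_of_mem (k, 0) (by simp)]
    · simp only [if_true]
    · intro x hx hxk
      have hx2 : x.2 ≠ 0 := fun h => hxk (Prod.ext (by simpa [h] using mem_antidiagonal.1 hx) h)
      rw [if_neg hx2, Pi.zero_apply]

end BigradedTaylorSeries

section RealPart

variable {E : Type*} [NormedAddCommGroup E] [NormedSpace ℂ E]

theorem HasBigradedTaylorSeries.re {f : E → ℂ} {F : ℕ × ℕ → E → ℂ}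
    (hf : HasBigradedTaylorSeries f F) :
    HasBigradedTaylorSeries (fun u => ((f u).re : ℂ))
      fun x u => (F x u + starRingEnd ℂ (F x.swap u)) / 2 := by
  have h := (hf.add hf.conj).const_smul (1 / 2)
  convert h using 1
  · funext u
    simp only [Pi.smul_apply, Pi.add_apply, smul_eq_mul, Complex.add_conj]
    push_cast
    ring
  · funext x u
    simp only [Pi.smul_apply, Pi.add_apply, smul_eq_mul]
    ring

end RealPart

theorem isBigO_sub_sub_fderiv {E F : Type*} [NormedAddCommGroup E] [NormedSpace ℝ E]
    [NormedAddCommGroup F] [NormedSpace ℝ F] {r : E → F} (hr : ContDiffAt ℝ 2 r 0) :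
    (fun p : E × E => r p.1 - r p.2 - fderiv ℝ r 0 (p.1 - p.2)) =O[𝓝 0]
      fun p => ‖p‖ * ‖p.1 - p.2‖ := by
  have hdiff : ∀ᶠ z in 𝓝 (0 : E), DifferentiableAt ℝ r z :=
    (hr.eventually (by norm_num)).mono fun z hz => hz.differentiableAt (by norm_num)
  have hfderiv : DifferentiableAt ℝ (fderiv ℝ r) 0 :=
    (hr.fderiv_right (m := 1) (by norm_num)).differentiableAt (by norm_num)
  obtain ⟨C, hC⟩ := hfderiv.isBigO_sub.bound
  obtain ⟨δ, hδ, hball⟩ := Metric.eventually_nhds_iff_ball.1 (hdiff.and hC)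
  refine .of_bound |C| ?_
  filter_upwards [Metric.ball_mem_nhds (0 : E × E) hδ] with p hp
  rw [mem_ball_zero_iff] at hp
  rw [norm_mul, norm_norm, norm_norm, ← mul_assoc]
  have hsubset : Metric.closedBall (0 : E) ‖p‖ ⊆ Metric.ball 0 δ := Metric.closedBall_subset_ball hp
  refine (convex_closedBall (0 : E) ‖p‖).norm_image_sub_le_of_norm_hasFDerivWithin_le'
    (fun x hx => (hball x (hsubset hx)).1.hasFDerivAt.hasFDerivWithinAt) (fun x hx => ?_)
    (mem_closedBall_zero_iff.2 (norm_snd_le p)) (mem_closedBall_zero_iff.2 (norm_fst_le p))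
  refine (hball x (hsubset hx)).2.trans ?_
  rw [sub_zero]
  gcongr
  · exact le_abs_self C
  · exact mem_closedBall_zero_iff.1 hx

theorem tendsto_zero_of_isBigO_norm {X Y : Type*} [NormedAddCommGroup X] [NormedAddCommGroup Y]
    {P : X → Y} (hP : P =O[𝓝 0] fun x => ‖x‖) : Filter.Tendsto P (𝓝 0) (𝓝 0) :=
  hP.trans_tendsto (continuous_norm.tendsto' _ _ norm_zero)

theorem isBigO_norm_of_analyticAt {X Y : Type*} [NormedAddCommGroup X] [NormedSpace ℂ X]
    [NormedAddCommGroup Y] [NormedSpace ℂ Y] {P : X → Y} (hP : AnalyticAt ℂ P 0) (h0 : P 0 = 0) :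
    P =O[𝓝 0] fun x => ‖x‖ := by
  simpa only [h0, sub_zero] using hP.differentiableAt.isBigO_sub.norm_right

/-- The terms of degree less than `n` of a bigraded series are all mixed: they involve both the
coordinates and their conjugates. -/
def HasNoPureTerms {X : Type*} (F : ℕ × ℕ → X → ℂ) (n : ℕ) : Prop :=
  ∀ x : ℕ × ℕ, x.1 + x.2 < n → x.1 = 0 ∨ x.2 = 0 → F x = 0

theorem HasNoPureTerms.mono {X : Type*} {F : ℕ × ℕ → X → ℂ} {m n : ℕ} (hF : HasNoPureTerms F n)
    (hmn : m ≤ n) : HasNoPureTerms F m :=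
  fun x hx => hF x (hx.trans_le hmn)

theorem HasNoPureTerms.comp {X Y : Type*} {F : ℕ × ℕ → X → ℂ} {n : ℕ} (hF : HasNoPureTerms F n)
    (T : Y → X) : HasNoPureTerms (fun x => F x ∘ T) n :=
  fun x hx h => funext fun u => congrFun (hF x hx h) (T u)

section NormalizedDefiningFunction

variable {E E' : Type*} [NormedAddCommGroup E] [NormedSpace ℂ E]
  [NormedAddCommGroup E'] [NormedSpace ℂ E']

/-- `r` is a smooth function near the origin of `E × ℂ` whose Taylor expansion starts with
`r (u, s) = Re s + ⋯`: the local defining function of a hypersurface, in coordinates in which the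
complex tangent space at the origin is `E × {0}`. -/
structure IsNormalized (r : E × ℂ → ℝ) : Prop where
  contDiffAt : ContDiffAt ℝ ∞ r 0
  map_zero : r 0 = 0
  fderiv_apply : ∀ x, fderiv ℝ r 0 x = x.2.re

namespace IsNormalized

variable {r : E × ℂ → ℝ}

theorem comp (hr : IsNormalized r) {Q : E' × ℂ → E × ℂ} (hQ : ContDiffAt ℂ ∞ Q 0) (hQ0 : Q 0 = 0)
    (hdQ : ∀ x, (fderiv ℂ Q 0 x).2 = x.2) : IsNormalized (r ∘ Q) where
  contDiffAt := (hQ0.symm ▸ hr.contDiffAt).comp 0 (hQ.restrict_scalars ℝ)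
  map_zero := by rw [Function.comp_apply, hQ0, hr.map_zero]
  fderiv_apply x := by
    have hQd := hQ.differentiableAt (by simp)
    rw [fderiv_comp 0 (hQ0.symm ▸ hr.contDiffAt.differentiableAt (by simp))
      (hQd.restrictScalars ℝ), ContinuousLinearMap.comp_apply, hQ0,
      hr.fderiv_apply, hQd.fderiv_restrictScalars ℝ,
      ContinuousLinearMap.coe_restrictScalars', hdQ]

theorem comp_prodMap_id (hr : IsNormalized r) (T : E' →L[ℂ] E) :
    IsNormalized (r ∘ Prod.map T id) := by
  let Q := T.prodMap (.id ℂ ℂ)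
  refine hr.comp (Q := Q) Q.contDiff.contDiffAt (_root_.map_zero Q) fun x => ?_
  rw [Q.fderiv]
  rfl

theorem isBigO_sub_sub_re (hr : IsNormalized r) {X : Type*} [NormedAddCommGroup X]
    {P Q : X → E × ℂ} (hP : P =O[𝓝 0] fun x => ‖x‖) (hQ : Q =O[𝓝 0] fun x => ‖x‖) :
    (fun x => r (P x) - r (Q x) - ((P x).2 - (Q x).2).re) =O[𝓝 0]
      fun x => ‖x‖ * ‖P x - Q x‖ := by
  have hPQ := hP.prod_left hQ
  have h := (isBigO_sub_sub_fderiv (hr.contDiffAt.of_le ENat.LEInfty.out)).comp_tendsto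
    (tendsto_zero_of_isBigO_norm hPQ)
  refine (h.trans (hPQ.norm_left.mul (Asymptotics.isBigO_refl _ _))).congr_left fun x => ?_
  rw [Function.comp_apply, hr.fderiv_apply, Prod.snd_sub]

theorem isBigO_graph_sub (hr : IsNormalized r) {h k : E → ℂ} (hh : h =O[𝓝 0] fun u => ‖u‖)
    (hk : k =O[𝓝 0] fun u => ‖u‖) :
    (fun u => r (u, h u) - r (u, k u) - (h u - k u).re) =O[𝓝 0] fun u => ‖u‖ * ‖h u - k u‖ := by
  have hid : (fun u : E => u) =O[𝓝 0] fun u => ‖u‖ := (Asymptotics.isBigO_refl _ _).norm_right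
  refine (hr.isBigO_sub_sub_re (hid.prod_left hh) (hid.prod_left hk)).congr_right fun u => ?_
  simp

theorem isBigO_graph_sub_add_re (hr : IsNormalized r) {h g : E → ℂ}
    (hh : h =O[𝓝 0] fun u => ‖u‖) (hhg : (fun u => h u - g u) =O[𝓝 0] fun u => ‖u‖) {n : ℕ}
    (hg : g =O[𝓝 0] fun u => ‖u‖ ^ n) :
    (fun u => r (u, h u - g u) - r (u, h u) + (g u).re) =O[𝓝 0] fun u => ‖u‖ ^ (n + 1) := by
  have hnorm : (fun u => ‖h u - g u - h u‖) =O[𝓝 0] fun u => ‖u‖ ^ n :=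
    hg.norm_left.congr_left fun u => by rw [sub_sub_cancel_left, norm_neg]
  refine ((hr.isBigO_graph_sub hhg hh).trans ((Asymptotics.isBigO_refl _ _).mul hnorm)).congr
    (fun u => ?_) fun u => (pow_succ' _ _).symm
  rw [sub_sub_cancel_left, Complex.neg_re, sub_neg_eq_add]

theorem isBigO_sub_base (hr : IsNormalized r) :
    (fun x => r x - r (x.1, 0) - x.2.re) =O[𝓝 0] fun x => ‖x‖ * ‖x.2‖ := by
  have hid : (fun x : E × ℂ => x) =O[𝓝 0] fun x => ‖x‖ := (Asymptotics.isBigO_refl _ _).norm_right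
  have hbase : (fun x : E × ℂ => (x.1, (0 : ℂ))) =O[𝓝 0] fun x => ‖x‖ :=
    .of_bound 1 (.of_forall fun x => by simpa using norm_fst_le x)
  refine (hr.isBigO_sub_sub_re hid hbase).congr (fun x => ?_) fun ⟨u, s⟩ => ?_ <;> simp

theorem isBigO_sub_base_add_re (hr : IsNormalized r) {h : E → ℂ} (hh : h =O[𝓝 0] fun u => ‖u‖)
    {j : ℕ} (hj : h =O[𝓝 0] fun u => ‖u‖ ^ j) :
    (fun u => r (u, h u) - (r (u, 0) + (h u).re)) =O[𝓝 0] fun u => ‖u‖ ^ (j + 1) := by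
  have hle := (hr.isBigO_graph_sub hh (Asymptotics.isBigO_zero _ _)).trans
    ((Asymptotics.isBigO_refl (fun u : E => ‖u‖) _).mul
      (hj.norm_left.congr_left fun u => by rw [sub_zero]))
  refine hle.congr (fun u => ?_) fun u => (pow_succ' _ _).symm
  rw [sub_zero, sub_sub]

theorem contDiffAt_graph (hr : IsNormalized r) {h : E → ℂ} (hh : AnalyticAt ℂ h 0)
    (h0 : h 0 = 0) : ContDiffAt ℝ ∞ (fun u => (r (u, h u) : ℂ)) 0 := by
  have hgraph : ContDiffAt ℝ ∞ (fun u => (u, h u)) 0 :=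
    contDiffAt_id.prodMk (hh.contDiffAt.restrict_scalars ℝ)
  have hr' : ContDiffAt ℝ ∞ r (0, h 0) := h0.symm ▸ hr.contDiffAt
  exact Complex.ofRealCLM.contDiff.contDiffAt.comp 0 (hr'.comp 0 hgraph)

theorem isBigO_base_sq (hr : IsNormalized r) : (fun u => r (u, 0)) =O[𝓝 0] fun u => ‖u‖ ^ 2 := by
  have hid : (fun u : E => (u, (0 : ℂ))) =O[𝓝 0] fun u => ‖u‖ :=
    .of_bound 1 (.of_forall fun u => by simp)
  have h := hr.isBigO_sub_sub_re hid (Asymptotics.isBigO_zero _ _)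
  refine h.congr (fun u => ?_) fun u => ?_
  · simp [hr.map_zero]
  · simp [pow_two]

variable [FiniteDimensional ℂ E]

theorem exists_hasNoPureTerms_succ (hr : IsNormalized r) {n : ℕ} (hn : 2 ≤ n) {h : E → ℂ}
    (hh : AnalyticAt ℂ h 0) (hO : h =O[𝓝 0] fun u => ‖u‖ ^ 2) {F : ℕ × ℕ → E → ℂ}
    (hF : HasBigradedTaylorSeries (fun u => (r (u, h u) : ℂ)) F) (hpure : HasNoPureTerms F n) :
    ∃ h' F', AnalyticAt ℂ h' 0 ∧ (h' =O[𝓝 0] fun u => ‖u‖ ^ 2) ∧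
      HasBigradedTaylorSeries (fun u => (r (u, h' u) : ℂ)) F' ∧ HasNoPureTerms F' (n + 1) := by
  have hgmem := (bihomogeneous E n 0).smul_mem 2 (hF.mem_bihomogeneous (n, 0))
  set g := (2 : ℂ) • F (n, 0) with hg
  have hgO : g =O[𝓝 0] fun u => ‖u‖ ^ n := isBigO_of_mem_bihomogeneous hgmem
  have hO' : (fun u => h u - g u) =O[𝓝 0] fun u => ‖u‖ ^ 2 :=
    hO.sub (hgO.trans (isBigO_norm_pow_of_le hn))
  have hle : (fun u : E => ‖u‖ ^ 2) =O[𝓝 0] fun u => ‖u‖ := by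
    simpa only [pow_one] using isBigO_norm_pow_of_le (E := E) one_le_two
  have hh' : AnalyticAt ℂ (fun u => h u - g u) 0 :=
    hh.sub (analyticAt_of_mem_bihomogeneous_zero hgmem 0)
  obtain ⟨F', hF'⟩ := exists_hasBigradedTaylorSeries
    (hr.contDiffAt_graph hh' (by simpa using hO'.eq_zero_imp.self_of_nhds))
  refine ⟨_, F', hh', hO', hF', fun x hx hx0 => ?_⟩
  have hdiff := (hF'.sub hF).add (HasBigradedTaylorSeries.single hgmem).re
  have hzero := hdiff.isBigO_iff.1 ((Complex.isBigO_ofReal_left.2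
    (hr.isBigO_graph_sub_add_re (hO.trans hle) (hO'.trans hle) hgO)).congr_left fun u => by
      simp) x hx
  funext u
  let S : ℕ × ℕ → E → ℂ := Pi.single (n, 0) g
  have hu : F' x u - F x u + (S x u + starRingEnd ℂ (S x.swap u)) / 2 = 0 := congrFun hzero u
  have hne : ((0, n) : ℕ × ℕ) ≠ (n, 0) := by
    simp only [ne_eq, Prod.ext_iff]
    omega
  obtain hlt | rfl | rfl : x.1 + x.2 < n ∨ x = (n, 0) ∨ x = (0, n) := by
    simp only [Prod.ext_iff]
    omega
  · have hx' : x ≠ (n, 0) ∧ x.swap ≠ (n, 0) := by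
      constructor <;> rintro h <;> simp only [Prod.ext_iff, Prod.fst_swap, Prod.snd_swap] at h <;>
        omega
    simpa [S, hx'.1, hx'.2, hpure x hlt hx0] using hu
  · simpa [S, hne, hg] using hu
  · have hconj := hF.conj_eq_swap (n, 0) u
    simpa [S, hne, hg, hconj, Complex.conj_ofNat] using hu

theorem exists_hasNoPureTerms (hr : IsNormalized r) (n : ℕ) :
    ∃ h F, AnalyticAt ℂ h 0 ∧ (h =O[𝓝 0] fun u => ‖u‖ ^ 2) ∧
      HasBigradedTaylorSeries (fun u => (r (u, h u) : ℂ)) F ∧ HasNoPureTerms F n := by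
  suffices H : ∀ n, 2 ≤ n → ∃ h F, AnalyticAt ℂ h 0 ∧ (h =O[𝓝 0] fun u => ‖u‖ ^ 2) ∧
      HasBigradedTaylorSeries (fun u => (r (u, h u) : ℂ)) F ∧ HasNoPureTerms F n by
    obtain ⟨h, F, hh, hO, hF, hpure⟩ := H (n + 2) (by omega)
    exact ⟨h, F, hh, hO, hF, fun x hx => hpure x (by omega)⟩
  intro n hn
  induction n, hn using Nat.le_induction with
  | base =>
    obtain ⟨F, hF⟩ := exists_hasBigradedTaylorSeries
      (hr.contDiffAt_graph (h := 0) analyticAt_const rfl)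
    exact ⟨0, F, analyticAt_const, Asymptotics.isBigO_zero _ _, hF, fun x hx _ =>
      hF.isBigO_iff.1 (Complex.isBigO_ofReal_left.2 hr.isBigO_base_sq) x hx⟩
  | succ n hn ih =>
    obtain ⟨h, F, hh, hO, hF, hpure⟩ := ih
    exact hr.exists_hasNoPureTerms_succ hn hh hO hF hpure

-- The Taylor series of `Re h` consists of pure terms, so they cannot cancel against the mixed
-- terms of `r (u, 0)`.
theorem isBigO_of_isBigO_graph (hr : IsNormalized r) {n : ℕ} {F : ℕ × ℕ → E → ℂ}
    (hF : HasBigradedTaylorSeries (fun u => (r (u, 0) : ℂ)) F) (hpure : HasNoPureTerms F n)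
    {h : E → ℂ} (hh : AnalyticAt ℂ h 0) (h0 : h 0 = 0)
    (hO : (fun u => r (u, h u)) =O[𝓝 0] fun u => ‖u‖ ^ n) : h =O[𝓝 0] fun u => ‖u‖ ^ n := by
  obtain ⟨H, hH, hHconj⟩ := exists_hasBigradedTaylorSeries_of_analyticAt hh
  have hhid := isBigO_norm_of_analyticAt hh h0
  suffices hj : ∀ j ≤ n, h =O[𝓝 0] fun u => ‖u‖ ^ j from hj n le_rfl
  intro j hj
  induction j with
  | zero => simpa only [pow_zero] using hh.continuousAt.isBigO_one ℝ
  | succ j ih =>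
    have hsmall : (fun u => r (u, 0) + (h u).re) =O[𝓝 0] fun u => ‖u‖ ^ (j + 1) := by
      refine ((hO.trans (isBigO_norm_pow_of_le hj)).sub
        (hr.isBigO_sub_base_add_re hhid (ih (by omega)))).congr_left fun u => ?_
      rw [sub_sub_cancel]
    have hsum := (hF.add hH.re).isBigO_iff.1
      ((Complex.isBigO_ofReal_left.2 hsmall).congr_left fun u => by simp)
    refine hH.isBigO_iff.2 fun x hx => ?_
    obtain ⟨k, q⟩ := x
    obtain rfl | hq := eq_or_ne q 0
    · obtain rfl | hk := eq_or_ne k 0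
      · exact hH.isBigO_iff.1 (hhid.congr_right fun u => (pow_one _).symm) _ one_pos
      · funext u
        have hu : F (k, 0) u + (H (k, 0) u + starRingEnd ℂ (H (0, k) u)) / 2 = 0 :=
          congrFun (hsum _ hx) u
        simpa [hpure (k, 0) (hx.trans_le hj) (.inr rfl), hHconj (0, k) hk] using hu
    · exact hHconj _ hq

theorem isBigO_base_of_isBigO_graph (hr : IsNormalized r) {n : ℕ} {F : ℕ × ℕ → E → ℂ}
    (hF : HasBigradedTaylorSeries (fun u => (r (u, 0) : ℂ)) F) (hpure : HasNoPureTerms F n)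
    {h : E → ℂ} (hh : AnalyticAt ℂ h 0) (h0 : h 0 = 0)
    (hO : (fun u => r (u, h u)) =O[𝓝 0] fun u => ‖u‖ ^ n) :
    (fun u => r (u, 0)) =O[𝓝 0] fun u => ‖u‖ ^ n := by
  have hhn := hr.isBigO_of_isBigO_graph hF hpure hh h0 hO
  refine ((hO.sub ((hr.isBigO_sub_base_add_re (isBigO_norm_of_analyticAt hh h0) hhn).trans
    (isBigO_norm_pow_of_le n.le_succ))).sub
      ((Complex.reCLM.isBigO_comp h _).trans hhn)).congr_left fun u => ?_
  rw [sub_sub_cancel, Complex.reCLM_apply, add_sub_cancel_right]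

end IsNormalized

end NormalizedDefiningFunction

section Submanifolds

variable {E F G : Type*} [NormedAddCommGroup E] [NormedSpace ℂ E] [NormedAddCommGroup F]
  [NormedSpace ℂ F] [NormedAddCommGroup G] [NormedSpace ℂ G]

theorem isSubmanifoldParam_clm {T : E →L[ℂ] F} (hT : Function.Injective T) :
    IsSubmanifoldParam T 0 :=
  ⟨T.analyticAt 0, map_zero T, by rwa [T.fderiv]⟩

namespace IsSubmanifoldParam

theorem comp {χ : F → G} {p : G} (hχ : IsSubmanifoldParam χ p) {φ : E → F}
    (hφ : IsSubmanifoldParam φ 0) : IsSubmanifoldParam (χ ∘ φ) p where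
  analyticAt := AnalyticAt.comp (hφ.map_zero.symm ▸ hχ.analyticAt) hφ.analyticAt
  map_zero := by rw [Function.comp_apply, hφ.map_zero, hχ.map_zero]
  injective_fderiv := by
    rw [fderiv_comp 0 (hφ.map_zero.symm ▸ hχ.analyticAt.differentiableAt)
      hφ.analyticAt.differentiableAt, hφ.map_zero]
    exact hχ.injective_fderiv.comp hφ.injective_fderiv

theorem tendsto {φ : E → F} (hφ : IsSubmanifoldParam φ 0) : Filter.Tendsto φ (𝓝 0) (𝓝 0) := by
  simpa only [hφ.map_zero] using hφ.analyticAt.continuousAt.tendsto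

theorem bijective_fderiv [FiniteDimensional ℂ E] [FiniteDimensional ℂ F] {φ : E → F} {p : F}
    (hφ : IsSubmanifoldParam φ p) (hdim : Module.finrank ℂ E = Module.finrank ℂ F) :
    Function.Bijective (fderiv ℂ φ 0) :=
  ⟨hφ.injective_fderiv, (LinearMap.injective_iff_surjective_of_finrank_eq_finrank
    (f := (fderiv ℂ φ 0 : E →ₗ[ℂ] F)) hdim).1 hφ.injective_fderiv⟩

theorem exists_inverse [FiniteDimensional ℂ E] [FiniteDimensional ℂ F] {φ : E → F}
    (hφ : IsSubmanifoldParam φ 0) (hdim : Module.finrank ℂ E = Module.finrank ℂ F) :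
    ∃ θ : F → E, IsSubmanifoldParam θ 0 ∧ (∀ᶠ x in 𝓝 0, θ (φ x) = x) ∧
      ∀ᶠ y in 𝓝 0, φ (θ y) = y := by
  have := FiniteDimensional.complete ℂ E
  have := FiniteDimensional.complete ℂ F
  let e : E ≃L[ℂ] F := (LinearEquiv.ofBijective (fderiv ℂ φ 0 : E →ₗ[ℂ] F)
    (hφ.bijective_fderiv hdim)).toContinuousLinearEquiv
  have hd : HasFDerivAt φ (e : E →L[ℂ] F) 0 := hφ.analyticAt.differentiableAt.hasFDerivAt
  have hc : ContDiffAt ℂ ω φ 0 := hφ.analyticAt.contDiffAt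
  have hs : HasStrictFDerivAt φ (e : E →L[ℂ] F) 0 := hc.hasStrictFDerivAt' hd (by simp)
  have hright := hs.eventually_right_inverse
  have hanalytic : AnalyticAt ℂ (hc.localInverse hd (by simp)) (φ 0) :=
    (hc.to_localInverse hd (by simp)).analyticAt
  have hderiv := hs.to_localInverse.hasFDerivAt
  have hzero := hs.localInverse_apply_image
  rw [hφ.map_zero] at hright hanalytic hderiv hzero
  refine ⟨hs.localInverse φ e 0, ⟨hanalytic, hzero, ?_⟩, hs.eventually_left_inverse, hright⟩
  rw [hderiv.fderiv]
  exact e.symm.injective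

end IsSubmanifoldParam

theorem IsNormalized.snd_fderiv_eq_zero {r : E × ℂ → ℝ} (hr : IsNormalized r) {χ : F → E × ℂ}
    (hχ : AnalyticAt ℂ χ 0) (h0 : χ 0 = 0) (hO : (r ∘ χ) =O[𝓝 0] fun x => ‖x‖ ^ 2) (x : F) :
    (fderiv ℂ χ 0 x).2 = 0 := by
  have hrχ : HasFDerivAt (r ∘ χ) (0 : F →L[ℝ] ℝ) 0 :=
    Asymptotics.IsBigO.hasFDerivAt (by simpa using hO) one_lt_two
  have hchain := (h0.symm ▸ hr.contDiffAt.differentiableAt (by simp)).hasFDerivAt.comp 0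
    (hχ.differentiableAt.hasFDerivAt.restrictScalars ℝ)
  have hre (y : F) : (fderiv ℂ χ 0 y).2.re = 0 := by
    simpa [h0, hr.fderiv_apply] using congrArg (· y) (hchain.unique hrχ)
  refine Complex.ext (hre x) ?_
  simpa using hre (Complex.I • x)

theorem IsSubmanifoldParam.fst_comp {r : E × ℂ → ℝ} (hr : IsNormalized r) {χ : F → E × ℂ}
    (hχ : IsSubmanifoldParam χ 0) (hO : (r ∘ χ) =O[𝓝 0] fun x => ‖x‖ ^ 2) :
    IsSubmanifoldParam (fun x => (χ x).1) 0 where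
  analyticAt := analyticAt_fst.comp hχ.analyticAt
  map_zero := by rw [hχ.map_zero, Prod.fst_zero]
  injective_fderiv x y hxy := by
    have hsnd := hr.snd_fderiv_eq_zero hχ.analyticAt hχ.map_zero hO
    rw [fderiv.fst hχ.analyticAt.differentiableAt] at hxy
    exact hχ.injective_fderiv (Prod.ext hxy ((hsnd x).trans (hsnd y).symm))

theorem exists_straightening {c : ℂ → E} (hc : IsSubmanifoldParam c 0) {e : E} (he : e ≠ 0) :
    ∃ σ : E → E, IsSubmanifoldParam σ 0 ∧ ∀ t : ℂ, σ (t • e) = c t := by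
  obtain ⟨ℓ, hℓ⟩ := SeparatingDual.exists_eq_one (R := ℂ) he
  have hv : fderiv ℂ c 0 1 ≠ 0 := (map_ne_zero_iff _ hc.injective_fderiv).2 one_ne_zero
  obtain ⟨T, hT⟩ := SeparatingDual.exists_continuousLinearEquiv_apply_eq (R := ℂ) he hv
  have hTe (t : ℂ) : T (t • e) = fderiv ℂ c 0 t := by
    rw [map_smul, hT, ← map_smul, smul_eq_mul, mul_one]
  have hcℓ : AnalyticAt ℂ c (ℓ 0) := by simpa only [map_zero] using hc.analyticAt
  have hderiv : HasFDerivAt (fun u => c (ℓ u) + T (u - ℓ u • e)) (T : E →L[ℂ] E) 0 := by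
    have hcd : HasFDerivAt c (fderiv ℂ c 0) (ℓ 0) := by
      simpa only [map_zero] using hc.analyticAt.differentiableAt.hasFDerivAt
    refine ((hcd.comp 0 ℓ.hasFDerivAt).add (T.hasFDerivAt.comp 0
      ((hasFDerivAt_id 0).sub (ℓ.hasFDerivAt.smul_const e)))).congr_fderiv ?_
    ext u
    simp [← hTe, -fderiv_eq_smul_deriv]
  refine ⟨fun u => c (ℓ u) + T (u - ℓ u • e), ⟨?_, ?_, ?_⟩, fun t => ?_⟩
  · exact (hcℓ.fun_comp (ℓ.analyticAt 0)).add
      ((T.analyticAt _).fun_comp (analyticAt_id.sub ((ℓ.analyticAt 0).smul analyticAt_const)))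
  · simp [hc.map_zero]
  · rw [hderiv.fderiv]
    exact T.injective
  · simp [hℓ]

theorem IsSubmanifoldParam.hasFDerivAt_prodMap_id {σ : E → F} (hσ : IsSubmanifoldParam σ 0) :
    HasFDerivAt (Prod.map σ (id : ℂ → ℂ)) ((fderiv ℂ σ 0).prodMap (.id ℂ ℂ)) 0 :=
  HasFDerivAt.prodMap (0 : E × ℂ) hσ.analyticAt.differentiableAt.hasFDerivAt (hasFDerivAt_id _)

theorem IsSubmanifoldParam.prodMap_id {σ : E → F} (hσ : IsSubmanifoldParam σ 0) :
    IsSubmanifoldParam (Prod.map σ (id : ℂ → ℂ)) 0 where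
  analyticAt := (hσ.analyticAt.comp_of_eq analyticAt_fst rfl).prod analyticAt_snd
  map_zero := Prod.ext hσ.map_zero rfl
  injective_fderiv := by
    rw [hσ.hasFDerivAt_prodMap_id.fderiv]
    exact hσ.injective_fderiv.prodMap Function.injective_id

theorem hasFDerivAt_shear {h : E → ℂ} (hO : h =O[𝓝 0] fun u => ‖u‖ ^ 2) :
    HasFDerivAt (fun x : E × ℂ => (x.1, x.2 + h x.1)) (.id ℂ (E × ℂ)) 0 := by
  have hh : HasFDerivAt h (0 : E →L[ℂ] ℂ) (0 : E × ℂ).1 :=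
    Asymptotics.IsBigO.hasFDerivAt (by simpa using hO) one_lt_two
  refine (hasFDerivAt_fst.prodMk (hasFDerivAt_snd.add (hh.comp 0 hasFDerivAt_fst))).congr_fderiv ?_
  ext <;> simp

theorem isSubmanifoldParam_shear {h : E → ℂ} (hh : AnalyticAt ℂ h 0)
    (hO : h =O[𝓝 0] fun u => ‖u‖ ^ 2) :
    IsSubmanifoldParam (fun x : E × ℂ => (x.1, x.2 + h x.1)) 0 where
  analyticAt := analyticAt_fst.prod (analyticAt_snd.add (hh.comp_of_eq analyticAt_fst rfl))
  map_zero := by simpa using hO.eq_zero_imp.self_of_nhds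
  injective_fderiv := by
    rw [(hasFDerivAt_shear hO).fderiv]
    exact Function.injective_id

end Submanifolds

section Charts

variable {E W : Type*} [NormedAddCommGroup E] [NormedSpace ℂ E] [NormedAddCommGroup W]
  [NormedSpace ℂ W] {R : W → ℝ} {γ : ℂ → W}

/-- Holomorphic coordinates `w = Ψ (u, s)` adapted to the hypersurface `R = 0` and to the curve `γ`:
`R` is normalized, the Taylor series `F` of its restriction to `s = 0` has no pure terms of degree
less than `n`, and `γ` is the graph of `g` over the complex line spanned by `e`. -/
structure IsAdaptedChart (R : W → ℝ) (γ : ℂ → W) (e : E) (n : ℕ) (Ψ : E × ℂ → W)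
    (F : ℕ × ℕ → E → ℂ) (g : ℂ → ℂ) : Prop where
  isSubmanifoldParam : IsSubmanifoldParam Ψ 0
  isNormalized : IsNormalized (R ∘ Ψ)
  hasBigradedTaylorSeries : HasBigradedTaylorSeries (fun u => (R (Ψ (u, 0)) : ℂ)) F
  hasNoPureTerms : HasNoPureTerms F n
  analyticAt_graph : AnalyticAt ℂ g 0
  graph_zero : g 0 = 0
  map_graph : ∀ t : ℂ, Ψ (t • e, g t) = γ t

namespace IsAdaptedChart

variable {e : E} {n : ℕ} {Ψ : E × ℂ → W} {F : ℕ × ℕ → E → ℂ} {g : ℂ → ℂ}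

theorem comp_prodMap (hΨ : IsAdaptedChart R γ e n Ψ F g) {T : E →L[ℂ] E}
    (hT : Function.Injective T) (hTe : T e = e) :
    IsAdaptedChart R γ e n (Ψ ∘ Prod.map T id) (fun x => F x ∘ T) g where
  isSubmanifoldParam := hΨ.isSubmanifoldParam.comp (isSubmanifoldParam_clm hT).prodMap_id
  isNormalized := hΨ.isNormalized.comp_prodMap_id T
  hasBigradedTaylorSeries := hΨ.hasBigradedTaylorSeries.comp_clm T
  hasNoPureTerms := hΨ.hasNoPureTerms.comp T
  analyticAt_graph := hΨ.analyticAt_graph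
  graph_zero := hΨ.graph_zero
  map_graph t := by simp [hTe, hΨ.map_graph]

theorem isBigO_of_contact (hΨ : IsAdaptedChart R γ e n Ψ F g) {k : ℕ} (hk : k ≤ n)
    (hO : (R ∘ γ) =O[𝓝 0] fun t => ‖t‖ ^ k) :
    (g =O[𝓝 0] fun t => ‖t‖ ^ k) ∧ (fun t : ℂ => R (Ψ (t • e, 0))) =O[𝓝 0] fun t => ‖t‖ ^ k := by
  let ι := ContinuousLinearMap.toSpanSingleton ℂ e
  have hnorm := hΨ.isNormalized.comp_prodMap_id ι
  have hF := hΨ.hasBigradedTaylorSeries.comp_clm ι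
  have hpure := (hΨ.hasNoPureTerms.mono hk).comp ι
  have hgraph : (fun t => (R ∘ Ψ) (ι t, g t)) =O[𝓝 0] fun t => ‖t‖ ^ k :=
    hO.congr_left fun t => congrArg R (hΨ.map_graph t).symm
  exact ⟨hnorm.isBigO_of_isBigO_graph hF hpure hΨ.analyticAt_graph hΨ.graph_zero hgraph,
    hnorm.isBigO_base_of_isBigO_graph hF hpure hΨ.analyticAt_graph hΨ.graph_zero hgraph⟩

end IsAdaptedChart

variable [FiniteDimensional ℂ E] [FiniteDimensional ℂ W]

theorem exists_continuousLinearEquiv_prod {ℓ : W →L[ℂ] ℂ} (hℓ : ℓ ≠ 0)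
    (hdim : Module.finrank ℂ (E × ℂ) = Module.finrank ℂ W) :
    ∃ L : (E × ℂ) ≃L[ℂ] W, ∀ x, ℓ (L x) = x.2 := by
  obtain ⟨w, hw⟩ := ContinuousLinearMap.exists_ne_zero hℓ
  have hright : Function.RightInverse (ContinuousLinearMap.toSpanSingleton ℂ ((ℓ w)⁻¹ • w)) ℓ :=
    fun s => by simp [hw]
  have hker := Module.Dual.finrank_ker_add_one_of_ne_zero (f := (ℓ : W →ₗ[ℂ] ℂ))
    (fun h => hℓ (ContinuousLinearMap.coe_injective h))
  rw [← hdim, Module.finrank_prod, Module.finrank_self, add_left_inj] at hker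
  let T : E ≃L[ℂ] ℓ.ker := .ofFinrankEq hker.symm
  refine ⟨(ContinuousLinearEquiv.prodComm ℂ E ℂ).trans (((ContinuousLinearEquiv.refl ℂ ℂ).prodCongr
    T).trans (.symm (.equivOfRightInverse ℓ _ hright))), fun x => ?_⟩
  have hT : ℓ (T x.1) = 0 := (T x.1).2
  simp [hT, hw]

theorem exists_linear_isNormalized {R : W → ℝ} (hR : ContDiffAt ℝ ∞ R 0) (hR0 : R 0 = 0)
    (hdR : fderiv ℝ R 0 ≠ 0) (hdim : Module.finrank ℂ (E × ℂ) = Module.finrank ℂ W) :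
    ∃ L : (E × ℂ) ≃L[ℂ] W, IsNormalized (R ∘ L) := by
  let ℓ : StrongDual ℂ W := StrongDual.extendRCLike (fderiv ℝ R 0)
  have hre (w : W) : (ℓ w).re = fderiv ℝ R 0 w := StrongDual.re_extendRCLike_apply (𝕜 := ℂ) _ _
  have hℓ : ℓ ≠ 0 := fun h => hdR <| ContinuousLinearMap.ext fun w => by simp [← hre, h]
  obtain ⟨L, hL⟩ := exists_continuousLinearEquiv_prod (E := E) hℓ hdim
  have hR' : ContDiffAt ℝ ∞ R (L 0) := by rwa [map_zero]
  have hLd : HasFDerivAt L ((L : (E × ℂ) →L[ℂ] W).restrictScalars ℝ) 0 :=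
    L.hasFDerivAt.restrictScalars ℝ
  refine ⟨L, hR'.comp 0 (L.contDiff.contDiffAt.restrict_scalars ℝ), ?_, fun x => ?_⟩
  · rw [Function.comp_apply, map_zero, hR0]
  · rw [((hR'.differentiableAt (by simp)).hasFDerivAt.comp 0 hLd).fderiv, map_zero,
      ContinuousLinearMap.comp_apply, ← hre, ← hL]
    rfl

theorem exists_straightened_chart (hR : ContDiffAt ℝ ∞ R 0) (hR0 : R 0 = 0)
    (hdR : fderiv ℝ R 0 ≠ 0) (hdim : Module.finrank ℂ (E × ℂ) = Module.finrank ℂ W)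
    (hγ : IsSubmanifoldParam γ 0) (hO : (R ∘ γ) =O[𝓝 0] fun t => ‖t‖ ^ 2) {e : E} (he : e ≠ 0) :
    ∃ (Ψ : E × ℂ → W) (k : ℂ → ℂ), IsSubmanifoldParam Ψ 0 ∧ IsNormalized (R ∘ Ψ) ∧
      AnalyticAt ℂ k 0 ∧ k 0 = 0 ∧ ∀ t : ℂ, Ψ (t • e, k t) = γ t := by
  obtain ⟨L, hL⟩ := exists_linear_isNormalized (E := E) hR hR0 hdR hdim
  have hχ : IsSubmanifoldParam (L.symm ∘ γ) 0 :=
    (isSubmanifoldParam_clm (T := (L.symm : W →L[ℂ] E × ℂ)) L.symm.injective).comp hγ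
  obtain ⟨σ, hσ, hσγ⟩ := exists_straightening
    (hχ.fst_comp hL (hO.congr_left fun t => by simp)) he
  refine ⟨_, fun t => (L.symm (γ t)).2,
    (isSubmanifoldParam_clm (T := (L : E × ℂ →L[ℂ] W)) L.injective).comp hσ.prodMap_id,
    hL.comp hσ.prodMap_id.analyticAt.contDiffAt hσ.prodMap_id.map_zero fun x => ?_,
    analyticAt_snd.comp hχ.analyticAt, ?_, fun t => ?_⟩
  · rw [hσ.hasFDerivAt_prodMap_id.fderiv]
    rfl
  · simp [hγ.map_zero]
  · simp [hσγ]

theorem exists_isAdaptedChart (hR : ContDiffAt ℝ ∞ R 0) (hR0 : R 0 = 0) (hdR : fderiv ℝ R 0 ≠ 0)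
    (hdim : Module.finrank ℂ (E × ℂ) = Module.finrank ℂ W) (hγ : IsSubmanifoldParam γ 0)
    (hO : (R ∘ γ) =O[𝓝 0] fun t => ‖t‖ ^ 2) {e : E} (he : e ≠ 0) (n : ℕ) :
    ∃ Ψ F g, IsAdaptedChart R γ e n Ψ F g := by
  obtain ⟨Ψ, k, hΨ, hnorm, hk, hk0, hγk⟩ := exists_straightened_chart hR hR0 hdR hdim hγ hO he
  obtain ⟨h, F, hh, hhO, hF, hpure⟩ := hnorm.exists_hasNoPureTerms n
  have h0 : h 0 = 0 := by simpa using hhO.eq_zero_imp.self_of_nhds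
  have hQ := isSubmanifoldParam_shear hh hhO
  have hhe : AnalyticAt ℂ (fun t : ℂ => h (t • e)) 0 :=
    AnalyticAt.fun_comp_of_eq hh (analyticAt_id.smul analyticAt_const) (zero_smul ℂ e)
  exact ⟨_, F, fun t => k t - h (t • e), {
    isSubmanifoldParam := hΨ.comp hQ
    isNormalized := hnorm.comp hQ.analyticAt.contDiffAt hQ.map_zero fun x => by
      rw [(hasFDerivAt_shear hhO).fderiv, ContinuousLinearMap.id_apply]
    hasBigradedTaylorSeries := by simpa using hF
    hasNoPureTerms := hpure
    analyticAt_graph := hk.sub hhe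
    graph_zero := by simp [hk0, h0]
    map_graph := fun t => by simp [hγk] }⟩

theorem IsAdaptedChart.eventually_mem_iff {e : E} {n : ℕ} {Ψ : E × ℂ → W} {F : ℕ × ℕ → E → ℂ}
    {g : ℂ → ℂ} (hΨ : IsAdaptedChart R γ e n Ψ F g)
    (hdim : Module.finrank ℂ (E × ℂ) = Module.finrank ℂ W) (he : e ≠ 0) {V : Set W}
    (hV : Filter.map γ (𝓝 0) = 𝓝[V] 0) :
    ∀ᶠ x in 𝓝 0, Ψ x ∈ V ↔ ∃ t : ℂ, x = (t • e, g t) := by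
  obtain ⟨θ, -, hθΨ, -⟩ := hΨ.isSubmanifoldParam.exists_inverse hdim
  obtain ⟨ℓ, hℓ⟩ := SeparatingDual.exists_eq_one (R := ℂ) he
  have hgraph : Filter.Tendsto (fun t : ℂ => (t • e, g t)) (𝓝 0) (𝓝 0) :=
    ((continuous_id.smul continuous_const).tendsto' 0 0 (zero_smul ℂ e)).prodMk_nhds
      (by simpa only [hΨ.graph_zero] using hΨ.analyticAt_graph.continuousAt.tendsto)
  have himage : ∀ᶠ w in 𝓝 0, w ∈ V → ∃ t : ℂ, θ (Ψ (t • e, g t)) = (t • e, g t) ∧ γ t = w := by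
    rw [← eventually_nhdsWithin_iff, ← hV]
    exact Filter.image_mem_map (hgraph.eventually hθΨ)
  have hmem : ∀ᶠ t in 𝓝 0, γ t ∈ V := Filter.eventually_map.1 (hV ▸ eventually_mem_nhdsWithin)
  have hcoord : Filter.Tendsto (fun x : E × ℂ => ℓ x.1) (𝓝 0) (𝓝 0) :=
    (ℓ.continuous.comp continuous_fst).tendsto' 0 0 (map_zero ℓ)
  filter_upwards [hθΨ, hΨ.isSubmanifoldParam.tendsto.eventually himage, hcoord.eventually hmem]
    with x hx hxV hxγ
  refine ⟨fun h => ?_, ?_⟩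
  · obtain ⟨t, ht, hγt⟩ := hxV h
    exact ⟨t, by rw [← hx, ← hγt, ← hΨ.map_graph, ht]⟩
  · rintro ⟨t, rfl⟩
    rw [hΨ.map_graph]
    simpa [hℓ] using hxγ

end Charts

theorem IsNormalized.isBigO_base_of_contact {E : Type*} [NormedAddCommGroup E] [NormedSpace ℂ E]
    [FiniteDimensional ℂ E] {r : E × ℂ → ℝ} (hr : IsNormalized r) {k : ℕ} (hk : 2 ≤ k)
    {F : ℕ × ℕ → E → ℂ} (hF : HasBigradedTaylorSeries (fun u => (r (u, 0) : ℂ)) F)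
    (hpure : HasNoPureTerms F k) {χ : E → E × ℂ} (hχ : IsSubmanifoldParam χ 0)
    (hO : (r ∘ χ) =O[𝓝 0] fun u => ‖u‖ ^ k) : (fun u => r (u, 0)) =O[𝓝 0] fun u => ‖u‖ ^ k := by
  obtain ⟨ρ, hρ, -, hρχ⟩ :=
    (hχ.fst_comp hr (hO.trans (isBigO_norm_pow_of_le hk))).exists_inverse rfl
  have hgraph : (fun u => r (u, (χ (ρ u)).2)) =O[𝓝 0] fun u => ‖u‖ ^ k := by
    refine ((hO.comp_tendsto hρ.tendsto).trans
      ((isBigO_norm_of_analyticAt hρ.analyticAt hρ.map_zero).norm_left.pow k)).congr' ?_ .rfl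
    filter_upwards [hρχ] with u hu
    exact congrArg r (Prod.ext hu rfl)
  have hχρ := hχ.comp hρ
  exact hr.isBigO_base_of_isBigO_graph hF hpure (analyticAt_snd.comp hχρ.analyticAt)
    (congrArg Prod.snd hχρ.map_zero) hgraph

section BloomGraham

variable {n : ℕ} {R : EuclideanSpace ℂ (Fin (n + 1)) → ℝ}

theorem natCast_lt_bloomGrahamType_iff {p : EuclideanSpace ℂ (Fin (n + 1))} {k : ℕ} :
    (k : ℕ∞) < bloomGrahamType R p ↔
      ∃ φ : EuclideanSpace ℂ (Fin n) → EuclideanSpace ℂ (Fin (n + 1)),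
        IsSubmanifoldParam φ p ∧ (R ∘ φ) =O[𝓝 0] fun ζ => ‖ζ‖ ^ (k + 1) := by
  simp only [bloomGrahamType, vanishingOrder, lt_iSup_iff]
  constructor
  · rintro ⟨φ, hφ, j, hj, hkj⟩
    exact ⟨φ, hφ, hj.trans (isBigO_norm_pow_of_le (Nat.cast_lt.1 hkj))⟩
  · rintro ⟨φ, hφ, hO⟩
    exact ⟨φ, hφ, k + 1, hO, Nat.cast_lt.2 k.lt_succ_self⟩

theorem one_lt_bloomGrahamType (hR : ContDiffAt ℝ ∞ R 0) (hR0 : R 0 = 0)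
    (hdR : fderiv ℝ R 0 ≠ 0) : 1 < bloomGrahamType R 0 := by
  obtain ⟨L, hL⟩ := exists_linear_isNormalized (E := EuclideanSpace ℂ (Fin n)) hR hR0 hdR (by simp)
  let φ := L.toContinuousLinearMap.comp (.inl ℂ (EuclideanSpace ℂ (Fin n)) ℂ)
  exact natCast_lt_bloomGrahamType_iff (k := 1).2 ⟨φ, isSubmanifoldParam_clm
    (L.injective.comp (Prod.mk_left_injective 0)), hL.isBigO_base_sq⟩

variable {γ : ℂ → EuclideanSpace ℂ (Fin (n + 1))} {e : EuclideanSpace ℂ (Fin n)} {N : ℕ}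
  {Ψ : EuclideanSpace ℂ (Fin n) × ℂ → EuclideanSpace ℂ (Fin (n + 1))}
  {F : ℕ × ℕ → EuclideanSpace ℂ (Fin n) → ℂ} {g : ℂ → ℂ}

namespace IsAdaptedChart

theorem natCast_lt_bloomGrahamType_iff (hΨ : IsAdaptedChart R γ e N Ψ F g) {k : ℕ} (hk : 1 ≤ k)
    (hkN : k < N) : (k : ℕ∞) < bloomGrahamType R 0 ↔ ∀ x : ℕ × ℕ, x.1 + x.2 < k + 1 → F x = 0 := by
  rw [← hΨ.hasBigradedTaylorSeries.isBigO_iff, Complex.isBigO_ofReal_left,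
    _root_.natCast_lt_bloomGrahamType_iff]
  constructor
  · rintro ⟨φ, hφ, hO⟩
    obtain ⟨θ, hθ, -, hΨθ⟩ := hΨ.isSubmanifoldParam.exists_inverse (by simp)
    refine hΨ.isNormalized.isBigO_base_of_contact (by omega) hΨ.hasBigradedTaylorSeries
      (hΨ.hasNoPureTerms.mono hkN) (hθ.comp hφ) (hO.congr' ?_ .rfl)
    filter_upwards [hφ.tendsto.eventually hΨθ] with u hu
    exact congrArg R hu.symm
  · let ι := ContinuousLinearMap.inl ℂ (EuclideanSpace ℂ (Fin n)) ℂ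
    exact fun hO => ⟨Ψ ∘ ι, hΨ.isSubmanifoldParam.comp
      (isSubmanifoldParam_clm (T := ι) (Prod.mk_left_injective 0)), hO⟩

theorem eq_zero_of_lt_bloomGrahamType (hΨ : IsAdaptedChart R γ e N Ψ F g) {m : ℕ}
    (hm : bloomGrahamType R 0 = m) (hm2 : 2 ≤ m) (hmN : m < N) {x : ℕ × ℕ} (hx : x.1 + x.2 < m) :
    F x = 0 := by
  obtain ⟨k, rfl⟩ := Nat.exists_eq_add_of_le' (one_le_two.trans hm2)
  refine (hΨ.natCast_lt_bloomGrahamType_iff (by omega) (by omega)).1 ?_ x hx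
  rw [hm]
  exact Nat.cast_lt.2 k.lt_succ_self

theorem exists_ne_zero_of_bloomGrahamType_eq (hΨ : IsAdaptedChart R γ e N Ψ F g) {m : ℕ}
    (hm : bloomGrahamType R 0 = m) (hm2 : 2 ≤ m) (hmN : m < N) :
    ∃ x : ℕ × ℕ, x.1 + x.2 = m ∧ F x ≠ 0 := by
  by_contra! h
  refine ((hΨ.natCast_lt_bloomGrahamType_iff (one_le_two.trans hm2) hmN).2 fun x hx => ?_).ne' hm
  obtain hlt | heq := Nat.lt_or_eq_of_le (Nat.lt_succ_iff.1 hx)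
  · exact hΨ.eq_zero_of_lt_bloomGrahamType hm hm2 hmN hlt
  · exact h x heq

end IsAdaptedChart

end BloomGraham

theorem exists_apply_eq_one_ne_zero_of_mem_bihomogeneous {E : Type*} [NormedAddCommGroup E]
    [NormedSpace ℂ E] {p q : ℕ} {F : E → ℂ} (hF : F ∈ bihomogeneous E p q) (hF0 : F ≠ 0)
    {f : E →L[ℂ] ℂ} (hf : f ≠ 0) : ∃ w, f w = 1 ∧ F w ≠ 0 := by
  by_contra! h
  have hdense : Dense (f ⁻¹' {0}ᶜ) :=
    (dense_compl_singleton 0).preimage (f.isOpenMap_of_ne_zero hf)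
  refine hF0 ((contDiff_of_mem_bihomogeneous hF).continuous.ext_on hdense continuous_const ?_)
  intro u (hu : f u ≠ 0)
  have hw : F ((f u)⁻¹ • u) = 0 := h _ (by simp [hu])
  rw [← smul_inv_smul₀ hu u, bihomogeneous_smul hF, hw, mul_zero, Pi.zero_apply]

theorem IsAdaptedChart.exists_apply_ne_zero {E W : Type*} [NormedAddCommGroup E] [NormedSpace ℂ E]
    [NormedAddCommGroup W] [NormedSpace ℂ W] {R : W → ℝ} {γ : ℂ → W} {e : E} {n : ℕ}
    {Ψ : E × ℂ → W} {F : ℕ × ℕ → E → ℂ} {g : ℂ → ℂ} (hΨ : IsAdaptedChart R γ e n Ψ F g)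
    {x : ℕ × ℕ} (hx : F x ≠ 0) {f : E →L[ℂ] ℂ} (hfe : f e = 0) {v : E} (hfv : f v = 1) :
    ∃ Ψ' F', IsAdaptedChart R γ e n Ψ' F' g ∧ F' x v ≠ 0 := by
  have hf : f ≠ 0 := fun h => by simp [h] at hfv
  obtain ⟨w, hfw, hFw⟩ := exists_apply_eq_one_ne_zero_of_mem_bihomogeneous
    (hΨ.hasBigradedTaylorSeries.mem_bihomogeneous x) hx hf
  let T : E →L[ℂ] E := .id ℂ E + f.smulRight (w - v)
  have hT (u : E) : T u = u + f u • (w - v) := rfl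
  have hfT (u : E) : f (T u) = f u := by simp [hT, hfw, hfv]
  have hinj : Function.Injective T := by
    rw [injective_iff_map_eq_zero]
    intro u hu
    have hfu : f u = 0 := by rw [← hfT, hu, map_zero]
    simpa [hT, hfu] using hu
  refine ⟨_, _, hΨ.comp_prodMap hinj (by simp [hT, hfe]), ?_⟩
  simpa [hT, hfv] using hFw

theorem span_range_pow_le_span_monomials {ι R A : Type*} [Fintype ι] [CommSemiring R]
    [CommSemiring A] [Algebra R A] (x : ι → A) (p : ℕ) :
    Submodule.span R (Set.range x) ^ p ≤
      Submodule.span R ((fun α : ι → ℕ => ∏ i, x i ^ α i) '' {α | ∑ i, α i = p}) := by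
  classical
  induction p with
  | zero =>
    rw [pow_zero, Submodule.one_eq_span]
    exact Submodule.span_mono fun a ha => ⟨0, by simp, by simpa using ha.symm⟩
  | succ p ih =>
    rw [pow_succ']
    refine (mul_le_mul' le_rfl ih).trans ?_
    rw [Submodule.span_mul_span]
    refine Submodule.span_mono ?_
    rintro _ ⟨_, ⟨i, rfl⟩, _, ⟨α, hα, rfl⟩, rfl⟩
    refine ⟨α + Pi.single i 1, ?_, ?_⟩
    · simpa [Finset.sum_add_distrib] using hα
    · simp only [Pi.add_apply, pow_add, Finset.prod_mul_distrib, mul_comm (x i)]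
      simp [Pi.single_apply]

section Monomials

theorem linearForms_le_span_coordinates {n : ℕ} :
    linearForms (EuclideanSpace ℂ (Fin n)) ≤
      Submodule.span ℂ (Set.range fun i (u : EuclideanSpace ℂ (Fin n)) => u i) := by
  rintro _ ⟨ℓ, rfl⟩
  have hℓ : ⇑ℓ = ∑ i, ℓ (EuclideanSpace.single i 1) • fun u : EuclideanSpace ℂ (Fin n) => u i := by
    funext u
    conv_lhs => rw [← (EuclideanSpace.basisFun (Fin n) ℂ).sum_repr u]
    simp [mul_comm]
  change ⇑ℓ ∈ _
  rw [hℓ]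
  exact Submodule.sum_mem _ fun i _ => Submodule.smul_mem _ _ (Submodule.subset_span ⟨i, rfl⟩)

theorem conjLinearForms_le_span_conj_coordinates {n : ℕ} :
    conjLinearForms (EuclideanSpace ℂ (Fin n)) ≤ Submodule.span ℂ
      (Set.range fun i (u : EuclideanSpace ℂ (Fin n)) => starRingEnd ℂ (u i)) := by
  refine (Submodule.map_mono linearForms_le_span_coordinates).trans ?_
  rw [Submodule.map_span, ← Set.range_comp]
  rfl

/-- The exponents `(α, β)` of the mixed monomials of bidegree `x`. -/
def bidegreeIndices (x : ℕ × ℕ) : Finset ((Fin 2 → ℕ) × (Fin 2 → ℕ)) :=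
  Finset.piAntidiag Finset.univ x.1 ×ˢ Finset.piAntidiag Finset.univ x.2

theorem mem_bidegreeIndices {x : ℕ × ℕ} {y : (Fin 2 → ℕ) × (Fin 2 → ℕ)} :
    y ∈ bidegreeIndices x ↔ multiLength y.1 = x.1 ∧ multiLength y.2 = x.2 := by
  simp [bidegreeIndices, multiLength]

theorem bihomogeneous_le_span_mixedMonomial (x : ℕ × ℕ) :
    bihomogeneous (EuclideanSpace ℂ (Fin 2)) x.1 x.2 ≤
      Submodule.span ℂ ((fun y : (Fin 2 → ℕ) × (Fin 2 → ℕ) => mixedMonomial y.1 y.2) ''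
        bidegreeIndices x) := by
  have hp := (pow_le_pow_left' (linearForms_le_span_coordinates (n := 2)) x.1).trans
    (span_range_pow_le_span_monomials _ x.1)
  have hq := (pow_le_pow_left' (conjLinearForms_le_span_conj_coordinates (n := 2)) x.2).trans
    (span_range_pow_le_span_monomials _ x.2)
  refine (mul_le_mul' hp hq).trans ?_
  rw [Submodule.span_mul_span]
  refine Submodule.span_mono ?_
  rintro _ ⟨_, ⟨α, hα, rfl⟩, _, ⟨β, hβ, rfl⟩, rfl⟩
  refine ⟨(α, β), mem_bidegreeIndices.2 ⟨hα, hβ⟩, ?_⟩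
  funext u
  simp [mixedMonomial]

theorem exists_eq_sum_mixedMonomial {F : ℕ × ℕ → EuclideanSpace ℂ (Fin 2) → ℂ}
    (hF : ∀ x, F x ∈ bihomogeneous (EuclideanSpace ℂ (Fin 2)) x.1 x.2) :
    ∃ a : (Fin 2 → ℕ) → (Fin 2 → ℕ) → ℂ, ∀ x u,
      F x u = ∑ y ∈ bidegreeIndices x, a y.1 y.2 * mixedMonomial y.1 y.2 u := by
  choose c hc using fun x => (Submodule.mem_span_image_finset_iff_exists_fun' ℂ).1
    (bihomogeneous_le_span_mixedMonomial x (hF x))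
  refine ⟨fun α β => c (multiLength α, multiLength β) (α, β), fun x u => ?_⟩
  rw [← hc, Finset.sum_apply]
  refine Finset.sum_congr rfl fun y hy => ?_
  obtain ⟨h₁, h₂⟩ := mem_bidegreeIndices.1 hy
  simp only [Pi.smul_apply, smul_eq_mul, h₁, h₂]

variable {F : ℕ × ℕ → EuclideanSpace ℂ (Fin 2) → ℂ} {a : (Fin 2 → ℕ) → (Fin 2 → ℕ) → ℂ}

theorem bigradedPartialSum_eq_sum_mixedIndices
    (ha : ∀ x u, F x u = ∑ y ∈ bidegreeIndices x, a y.1 y.2 * mixedMonomial y.1 y.2 u) {m η : ℕ}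
    (hpure : HasNoPureTerms F (η + 1)) (hlow : ∀ x : ℕ × ℕ, x.1 + x.2 < m → F x = 0)
    (u : EuclideanSpace ℂ (Fin 2)) : bigradedPartialSum F (η + 1) u =
      ∑ y ∈ mixedIndices m η, a y.1 y.2 * mixedMonomial y.1 y.2 u := by
  rw [← Finset.sum_fiberwise_of_maps_to (s := mixedIndices m η) (t := Finset.range (η + 1))
    (g := fun y => multiLength y.1 + multiLength y.2)
    (fun y hy => Finset.mem_range.2 (Nat.lt_succ_of_le ((mem_mixedIndices m η y).1 hy).2.2.2))]
  refine Finset.sum_congr rfl fun k hk => ?_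
  rw [← Finset.sum_fiberwise_of_maps_to (t := antidiagonal k)
    (g := fun y : (Fin 2 → ℕ) × (Fin 2 → ℕ) => (multiLength y.1, multiLength y.2))
    (fun y hy => mem_antidiagonal.2 (Finset.mem_filter.1 hy).2)]
  refine Finset.sum_congr rfl fun x hx => ?_
  have hxk := mem_antidiagonal.1 hx
  have hkη := Finset.mem_range.1 hk
  by_cases h : 0 < x.1 ∧ 0 < x.2 ∧ m ≤ k
  · rw [ha]
    refine Finset.sum_congr (Finset.ext fun y => ?_) fun _ _ => rfl
    simp only [mem_bidegreeIndices, Finset.mem_filter, mem_mixedIndices, Prod.ext_iff]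
    omega
  · have hFx : F x = 0 := by
      by_cases hxm : x.1 + x.2 < m
      · exact hlow x hxm
      · exact hpure x (by omega) (by omega)
    rw [hFx, Pi.zero_apply]
    refine (Finset.sum_eq_zero fun y hy => ?_).symm
    simp only [Finset.mem_filter, mem_mixedIndices, Prod.ext_iff] at hy
    omega

theorem eq_coefficient_of_eq_sum_mixedMonomial
    (ha : ∀ x u, F x u = ∑ y ∈ bidegreeIndices x, a y.1 y.2 * mixedMonomial y.1 y.2 u)
    (x : ℕ × ℕ) : F x !₂[0, 1] = a ![0, x.1] ![0, x.2] := by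
  rw [ha, Finset.sum_eq_single_of_mem (![0, x.1], ![0, x.2])
    (mem_bidegreeIndices.2 (by simp [multiLength]))]
  · simp [mixedMonomial]
  · rintro ⟨α, β⟩ hy hne
    obtain ⟨hα, hβ⟩ := mem_bidegreeIndices.1 hy
    simp only [multiLength, Fin.sum_univ_two] at hα hβ
    have hαβ : α 0 ≠ 0 ∨ β 0 ≠ 0 := by
      by_contra! h
      refine hne (Prod.ext ?_ ?_) <;> ext i <;> fin_cases i <;> simp <;> omega
    obtain h | h := hαβ <;> simp [mixedMonomial, h]

end Monomials

theorem isBigO_comp_of_map_eq_nhdsWithin {W : Type*} [NormedAddCommGroup W] [NormedSpace ℂ W]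
    {R : W → ℝ} {V : Set W} {γ : ℂ → W} (hγ : IsSubmanifoldParam γ 0)
    (hV : Filter.map γ (𝓝 0) = 𝓝[V] 0) {k : ℕ} {C : ℝ}
    (hC : ∀ᶠ w in 𝓝[V] 0, |R w| ≤ C * ‖w‖ ^ k) : (R ∘ γ) =O[𝓝 0] fun t => ‖t‖ ^ k := by
  rw [← hV, Filter.eventually_map] at hC
  refine .trans (.of_bound C ?_)
    ((isBigO_norm_of_analyticAt hγ.analyticAt hγ.map_zero).norm_left.pow k)
  filter_upwards [hC] with t ht
  simpa using ht

theorem IsSmoothlyBoundedDomain.eq_zero_of_mem_frontier {n : ℕ} {Ω : Set (EuclideanSpace ℂ (Fin n))}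
    {R : EuclideanSpace ℂ (Fin n) → ℝ} (hΩ : IsSmoothlyBoundedDomain Ω R)
    {p : EuclideanSpace ℂ (Fin n)} (hp : p ∈ frontier Ω) : R p = 0 := by
  rw [hΩ.eq_sublevel] at hp
  exact frontier_lt_subset_eq hΩ.contDiff.continuous continuous_const hp

/-- The identification of `ℂ³` with `ℂ² × ℂ` which splits `z` into `z' = (z₁, z₂)` and `z₃`. -/
noncomputable def splitLast : EuclideanSpace ℂ (Fin 3) →L[ℂ] EuclideanSpace ℂ (Fin 2) × ℂ :=
  LinearMap.toContinuousLinearMap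
    { toFun := fun z => (firstTwo z, z 2)
      map_add' := fun z w => Prod.ext (by ext i; fin_cases i <;> simp [firstTwo]) rfl
      map_smul' := fun c z => Prod.ext (by ext i; fin_cases i <;> simp [firstTwo]) rfl }

theorem splitLast_apply (z : EuclideanSpace ℂ (Fin 3)) : splitLast z = (firstTwo z, z 2) := rfl

theorem injective_splitLast : Function.Injective splitLast := by
  intro z w h
  simp only [splitLast_apply, firstTwo, Prod.mk.injEq] at h
  ext i
  fin_cases i
  · exact congrArg (· 0) h.1
  · exact congrArg (· 1) h.1
  · exact h.2

theorem tendsto_splitLast : Filter.Tendsto splitLast (𝓝 0) (𝓝 0) :=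
  splitLast.continuous.tendsto' 0 0 (map_zero _)

namespace IsAdaptedChart

variable {R : EuclideanSpace ℂ (Fin 3) → ℝ} {γ : ℂ → EuclideanSpace ℂ (Fin 3)}
  {e : EuclideanSpace ℂ (Fin 2)} {N : ℕ}
  {Ψ : EuclideanSpace ℂ (Fin 2) × ℂ → EuclideanSpace ℂ (Fin 3)}
  {F : ℕ × ℕ → EuclideanSpace ℂ (Fin 2) → ℂ} {g : ℂ → ℂ}

theorem isHolomorphicCoordinates (hΨ : IsAdaptedChart R γ e N Ψ F g) :
    IsHolomorphicCoordinates (Ψ ∘ splitLast) :=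
  have h := hΨ.isSubmanifoldParam.comp (isSubmanifoldParam_clm injective_splitLast)
  ⟨h.analyticAt, h.map_zero, h.bijective_fderiv rfl⟩

theorem isBigO_sub_re_sub_partialSum (hΨ : IsAdaptedChart R γ e N Ψ F g) (n : ℕ) :
    (fun z => (R (Ψ (splitLast z)) : ℂ) - ((z 2).re : ℂ) - bigradedPartialSum F n (firstTwo z))
      =O[𝓝 0] fun z => ‖z 2‖ * ‖z‖ + ‖firstTwo z‖ ^ n := by
  have hbase := (hΨ.isNormalized.isBigO_sub_base.comp_tendsto tendsto_splitLast).trans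
    ((splitLast.isBigO_id (𝓝 0)).norm_norm.mul
      (Asymptotics.isBigO_refl (fun z => ‖(splitLast z).2‖) _))
  have hseries := (hΨ.hasBigradedTaylorSeries.isBigO_sub_partialSum n).comp_tendsto
    ((continuous_fst.tendsto' 0 0 rfl).comp tendsto_splitLast)
  have h₁ : (fun z : EuclideanSpace ℂ (Fin 3) => ‖z‖ * ‖z 2‖) =O[𝓝 0]
      fun z => ‖z 2‖ * ‖z‖ + ‖firstTwo z‖ ^ n :=
    .of_norm_le fun z => by rw [Real.norm_of_nonneg (by positivity), mul_comm]; simp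
  have h₂ : (fun z => ‖firstTwo z‖ ^ n) =O[𝓝 0] fun z => ‖z 2‖ * ‖z‖ + ‖firstTwo z‖ ^ n :=
    .of_norm_le fun z => by rw [Real.norm_of_nonneg (by positivity)]; simpa using by positivity
  refine ((Complex.isBigO_ofReal_left.2 (hbase.trans h₁)).add (hseries.trans h₂)).congr_left
    fun z => ?_
  simp only [Function.comp_apply, splitLast_apply]
  push_cast
  ring

theorem eventually_mem_iff_coordinates (hΨ : IsAdaptedChart R γ !₂[1, 0] N Ψ F g)
    {V : Set (EuclideanSpace ℂ (Fin 3))} (hV : Filter.map γ (𝓝 0) = 𝓝[V] 0) :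
    ∀ᶠ z in 𝓝 0, Ψ (splitLast z) ∈ V ↔ z 1 = 0 ∧ z 2 = g (z 0) := by
  have he : (!₂[1, 0] : EuclideanSpace ℂ (Fin 2)) ≠ 0 := fun h => by simpa using congrArg (· 0) h
  filter_upwards [tendsto_splitLast.eventually (hΨ.eventually_mem_iff (by simp) he hV)] with z hz
  rw [hz]
  simp only [splitLast_apply, firstTwo, Prod.mk.injEq, PiLp.ext_iff, Fin.forall_fin_two]
  constructor
  · rintro ⟨t, ⟨h₀, h₁⟩, h₂⟩
    simp_all
  · rintro ⟨h₁, h₂⟩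
    exact ⟨z 0, by simp [h₁], h₂⟩

theorem isBigO_axis_of_contact (hΨ : IsAdaptedChart R γ !₂[1, 0] N Ψ F g) {k : ℕ} (hk : k ≤ N)
    (hO : (R ∘ γ) =O[𝓝 0] fun t => ‖t‖ ^ k) :
    (fun t : ℂ => R (Ψ (splitLast !₂[t, 0, 0]))) =O[𝓝 0] fun t => ‖t‖ ^ k := by
  refine (hΨ.isBigO_of_contact hk hO).2.congr_left fun t => congrArg (R ∘ Ψ) (Prod.ext ?_ rfl)
  ext i
  fin_cases i <;> simp [splitLast_apply, firstTwo]

end IsAdaptedChart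

theorem exists_isAdaptedChart_apply_ne_zero {R : EuclideanSpace ℂ (Fin 3) → ℝ}
    (hR : ContDiffAt ℝ ∞ R 0) (hR0 : R 0 = 0) (hdR : fderiv ℝ R 0 ≠ 0) {m : ℕ}
    (hm : bloomGrahamType R 0 = m) {γ : ℂ → EuclideanSpace ℂ (Fin 3)} (hγ : IsSubmanifoldParam γ 0)
    {η : ℕ} (hmη : m ≤ η) (hO : (R ∘ γ) =O[𝓝 0] fun t => ‖t‖ ^ η) :
    ∃ (Ψ : EuclideanSpace ℂ (Fin 2) × ℂ → EuclideanSpace ℂ (Fin 3))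
      (F : ℕ × ℕ → EuclideanSpace ℂ (Fin 2) → ℂ) (g : ℂ → ℂ),
      IsAdaptedChart R γ !₂[1, 0] (η + 1) Ψ F g ∧
      (∀ x : ℕ × ℕ, x.1 + x.2 < m → F x = 0) ∧
      ∃ x : ℕ × ℕ, 0 < x.1 ∧ 0 < x.2 ∧ x.1 + x.2 = m ∧ F x !₂[0, 1] ≠ 0 := by
  have hm2 : 2 ≤ m := Nat.cast_lt.1 (hm ▸ one_lt_bloomGrahamType hR hR0 hdR)
  have he : (!₂[1, 0] : EuclideanSpace ℂ (Fin 2)) ≠ 0 := fun h => by simpa using congrArg (· 0) h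
  obtain ⟨Ψ₀, F₀, g, hΨ₀⟩ := exists_isAdaptedChart hR hR0 hdR (by simp) hγ
    (hO.trans (isBigO_norm_pow_of_le (hm2.trans hmη))) he (η + 1)
  obtain ⟨x, hxm, hx⟩ := hΨ₀.exists_ne_zero_of_bloomGrahamType_eq hm hm2 (by omega)
  obtain ⟨Ψ, F, hΨ, hFx⟩ := hΨ₀.exists_apply_ne_zero hx (f := EuclideanSpace.proj 1)
    (v := !₂[0, 1]) (by simp) (by simp)
  refine ⟨Ψ, F, g, hΨ, fun y => hΨ.eq_zero_of_lt_bloomGrahamType hm hm2 (by omega), x, ?_, ?_, hxm,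
    hFx⟩ <;> refine Nat.pos_of_ne_zero fun h => hFx ?_
  · rw [hΨ.hasNoPureTerms x (by omega) (.inl h), Pi.zero_apply]
  · rw [hΨ.hasNoPureTerms x (by omega) (.inr h), Pi.zero_apply]

theorem theorem2p1_general {R : EuclideanSpace ℂ (Fin 3) → ℝ} (hR : ContDiffAt ℝ ∞ R 0)
    (hR0 : R 0 = 0) (hdR : fderiv ℝ R 0 ≠ 0) {m : ℕ} (hm : bloomGrahamType R 0 = m)
    {V : Set (EuclideanSpace ℂ (Fin 3))} (hV : IsSmoothCurveAt V 0) {η : ℕ} (hmη : m ≤ η)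
    (hcontact : ∃ C : ℝ, ∀ᶠ w in 𝓝[V] 0, |R w| ≤ C * ‖w‖ ^ η) :
    ∃ (Ψ : EuclideanSpace ℂ (Fin 3) → EuclideanSpace ℂ (Fin 3))
      (a : (Fin 2 → ℕ) → (Fin 2 → ℕ) → ℂ),
      IsHolomorphicCoordinates Ψ ∧
      ((fun z : EuclideanSpace ℂ (Fin 3) =>
          ((R (Ψ z) : ℝ) : ℂ) - (((z 2).re : ℝ) : ℂ)
            - ∑ x ∈ mixedIndices m η, a x.1 x.2 * mixedMonomial x.1 x.2 (firstTwo z))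
        =O[𝓝 0] fun z => ‖z 2‖ * ‖z‖ + ‖firstTwo z‖ ^ (η + 1)) ∧
      (∃ g : ℂ → ℂ, AnalyticAt ℂ g 0 ∧ (g =O[𝓝 0] fun t => ‖t‖ ^ η) ∧
        ∀ᶠ z in 𝓝 (0 : EuclideanSpace ℂ (Fin 3)), Ψ z ∈ V ↔ z 1 = 0 ∧ z 2 = g (z 0)) ∧
      ((fun t : ℂ => R (Ψ !₂[t, 0, 0])) =O[𝓝 0] fun t => ‖t‖ ^ η) ∧
      ∃ α₂ β₂ : ℕ, 0 < α₂ ∧ 0 < β₂ ∧ α₂ + β₂ = m ∧ a ![0, α₂] ![0, β₂] ≠ 0 := by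
  obtain ⟨γ, hγ, hγV⟩ := hV
  obtain ⟨C, hC⟩ := hcontact
  have hO := isBigO_comp_of_map_eq_nhdsWithin hγ hγV hC
  obtain ⟨Ψ, F, g, hΨ, hlow, x, hx₁, hx₂, hxm, hFx⟩ :=
    exists_isAdaptedChart_apply_ne_zero hR hR0 hdR hm hγ hmη hO
  obtain ⟨a, ha⟩ := exists_eq_sum_mixedMonomial hΨ.hasBigradedTaylorSeries.mem_bihomogeneous
  refine ⟨Ψ ∘ splitLast, a, hΨ.isHolomorphicCoordinates, ?_,
    ⟨g, hΨ.analyticAt_graph, (hΨ.isBigO_of_contact η.le_succ hO).1,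
      hΨ.eventually_mem_iff_coordinates hγV⟩,
    hΨ.isBigO_axis_of_contact η.le_succ hO, x.1, x.2, hx₁, hx₂, hxm, ?_⟩
  · simpa only [Function.comp_apply,
      bigradedPartialSum_eq_sum_mixedIndices ha hΨ.hasNoPureTerms hlow] using
      hΨ.isBigO_sub_re_sub_partialSum (η + 1)
  · rwa [← eq_coefficient_of_eq_sum_mixedMonomial ha]

theorem theorem2p1
    (Ω : Set (EuclideanSpace ℂ (Fin 3))) (R : EuclideanSpace ℂ (Fin 3) → ℝ)
    (hΩ : IsSmoothlyBoundedDomain Ω R) (hpsc : IsLeviPseudoconvex Ω R)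
    (h0 : (0 : EuclideanSpace ℂ (Fin 3)) ∈ frontier Ω)
    (m : ℕ) (hm : bloomGrahamType R 0 = (m : ℕ∞))
    (V : Set (EuclideanSpace ℂ (Fin 3))) (hV : IsSmoothCurveAt V 0)
    (η : ℕ) (hmη : m ≤ η)
    (hcontact : ∃ C : ℝ, ∀ᶠ w in 𝓝[V] (0 : EuclideanSpace ℂ (Fin 3)), |R w| ≤ C * ‖w‖ ^ η) :
    ∃ (Ψ : EuclideanSpace ℂ (Fin 3) → EuclideanSpace ℂ (Fin 3))
      (a : (Fin 2 → ℕ) → (Fin 2 → ℕ) → ℂ),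
      IsHolomorphicCoordinates Ψ ∧
      -- the normal form of `r = R ∘ Ψ`
      ((fun z : EuclideanSpace ℂ (Fin 3) =>
          ((R (Ψ z) : ℝ) : ℂ) - (((z 2).re : ℝ) : ℂ)
            - ∑ x ∈ mixedIndices m η, a x.1 x.2 * mixedMonomial x.1 x.2 (firstTwo z))
        =O[𝓝 0] fun z => ‖z 2‖ * ‖z‖ + ‖firstTwo z‖ ^ (η + 1)) ∧
      -- `V` is the `z₁`-axis to order `η`
      (∃ g : ℂ → ℂ, AnalyticAt ℂ g 0 ∧ (g =O[𝓝 0] fun t => ‖t‖ ^ η) ∧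
        ∀ᶠ z in 𝓝 (0 : EuclideanSpace ℂ (Fin 3)), Ψ z ∈ V ↔ z 1 = 0 ∧ z 2 = g (z 0)) ∧
      -- `|r(t, 0, 0)| ≲ |t| ^ η`
      ((fun t : ℂ => R (Ψ !₂[t, 0, 0])) =O[𝓝 0] fun t => ‖t‖ ^ η) ∧
      -- a nonzero mixed term of degree `m` in `z₂`
      ∃ α₂ β₂ : ℕ, 0 < α₂ ∧ 0 < β₂ ∧ α₂ + β₂ = m ∧ a ![0, α₂] ![0, β₂] ≠ 0 :=
  theorem2p1_general hΩ.contDiff.contDiffAt (hΩ.eq_zero_of_mem_frontier h0)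
    (hΩ.fderiv_ne_zero 0 h0) hm hV hmη hcontact
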